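/- Let $\Theta=[0,1]$ and consider a stochastic bandit with arms $1,\dots,K$ ($K\ge 1$): the rewards $X_{a,n}$ ($1\le a\le K$, $n\ge 1$) are independent, and $X_{a,n}$ has law $\nu_a$, a probability distribution on $\Theta$ with mean $\mu_a$. In round $t=1,2,\dots$ an arm $A_t$ is chosen as a function of the past actions and observed rewards and possibly of some randomization independent of the rewards, and the reward $X_{A_t,N_{A_t}(t)}$ is received, where $N_a(t)=\sum_{s=1}^t\mathbf 1\{A_s=a\}$. Let $\bar X_a(t)$ be the empirical mean of the rewards received from arm $a$ up to round $t$, $\mu^*=\max_a\mu_a$, $\Delta_a=\mu^*-\mu_a$, and let $\mathbb E[R(T)]=\mathbb E\big[T\mu^*-\sum_{t=1}^T X_{A_t,N_{A_t}(t)}\big]$ be the expected regret. Let $d_{kl}(p,q)=p\log\frac pq+(1-p)\log\frac{1-p}{1-q}\in[0,+\infty]$. An extended-real-valued function $d$ on $\Theta\times\Theta$ is called a candidate semi-distance function if $d(p,p)\le 0$ for all $p$, $d(p,q)\le d(p,q')$ for $p\le q\le q'$, and $d(p,q)\ge d(p',q)$ for $p\le p'\le q$. It is called a strong semi-distance function if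 it satisfies the same two monotonicity conditions, $d\ge 0$, and $d(p,q)=0$ if and only if $p=q$. Let $D$ be a feasible set of candidate semi-distance functions, that is, a set of such functions for which $\max_{d\in D}d$ is a strong semi-distance function and $\max_{d\in D}d\le d_{kl}$ on $\Theta\times\Theta$. Assume moreover that (i) for all $d\in D$, $p\in\Theta$ and $\delta>0$ the maximum $\max\{q\in\Theta: d(p,q)\le\delta\}$ exists; (ii) for all $p<q$ in $\Theta$ the function $p'\mapsto \max_{d\in D}d(p',q)$ is continuous from the right at $p'=p$. Let UCBoost($D$) be the algorithm that plays $A_t=t$ for $t=1,\dots,K$ and, for $t\ge K+1$, $$A_t\in\arg\max_{a}\ \min_{d\in D}\ \max\{q\in\Theta: N_a(t-1)\,d(\bar X_a(t-1),q)\le \log t+c\log\log t\},$$ with ties broken in any way. (If $D$ is infinite, the maximum and minimum over $d\in D$ are read as supremum and infimum.) Then with $c=3$ the expected regret of UCBoost($D$) satisfies $$\limsup_{T\to\infty}\frac{\mathbb E[R(T)]}{\log T}\ \le\ \sum_{a:\,\mu_a<\mu^*}\frac{\Delta_a}{\max_{d\in D}d(\mu_a,\mu^*)},$$ where a term with denominator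 $+\infty$ is $0$. -/

import Mathlib

open MeasureTheory ProbabilityTheory Filter Topology

namespace UCBoost

/-- The reward interval `Θ = [0,1]`. -/
abbrev Θ : Type := ↥(Set.Icc (0 : ℝ) 1)

/-! ### Semi-distance functions

Functions on `Θ × Θ` take extended-real values, since `kl(p,1) = +∞` for `p < 1`;
real-valued functions are included through the coercion `ℝ → EReal`. -/

/-- Candidate semi-distance functions. -/
structure IsCandidateSemiDistance (d : Θ → Θ → EReal) : Prop where
  self_nonpos : ∀ p, d p p ≤ 0
  mono_right : ∀ p q q', p ≤ q → q ≤ q' → d p q ≤ d p q'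
  anti_left : ∀ p p' q, p ≤ p' → p' ≤ q → d p' q ≤ d p q

/-- Strong semi-distance functions. -/
structure IsStrongSemiDistance (d : Θ → Θ → EReal) : Prop where
  nonneg : ∀ p q, 0 ≤ d p q
  eq_zero_iff : ∀ p q, d p q = 0 ↔ p = q
  mono_right : ∀ p q q', p ≤ q → q ≤ q' → d p q ≤ d p q'
  anti_left : ∀ p p' q, p ≤ p' → p' ≤ q → d p' q ≤ d p q

/-- `x * log (x / y)` for `x, y ≥ 0`, with the conventions `0 * log (0 / y) = 0` (also for
`y = 0`) and `x * log (x / 0) = +∞` for `x > 0`. -/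
noncomputable def klTerm (x y : ℝ) : EReal :=
  if x = 0 then 0 else if y = 0 then ⊤ else ((x * Real.log (x / y) : ℝ) : EReal)

/-- The Kullback-Leibler divergence between the Bernoulli distributions with means `p`, `q`. -/
noncomputable def dkl (p q : Θ) : EReal :=
  klTerm (p : ℝ) (q : ℝ) + klTerm (1 - (p : ℝ)) (1 - (q : ℝ))

/-- kl-dominated functions. -/
def IsKLDominated (d : Θ → Θ → EReal) : Prop := ∀ p q, d p q ≤ dkl p q

/-- The pointwise maximum `max_{d ∈ D} d` (the supremum, if `D` is infinite). -/
noncomputable def maxOf (D : Set (Θ → Θ → EReal)) (p q : Θ) : EReal := ⨆ d ∈ D, d p q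

/-- Feasible sets: the maximum is a strong semi-distance function and is kl-dominated. -/
structure IsFeasible (D : Set (Θ → Θ → EReal)) : Prop where
  strong : IsStrongSemiDistance (maxOf D)
  dominated : IsKLDominated (maxOf D)

/-- The problem "maximize `q ∈ Θ` subject to `d(p,q) ≤ δ`" has a solution, for every mean `p`
and every bonus `δ > 0`: the maxima in the definition of the indices exist. -/
def IndexExists (d : Θ → Θ → EReal) : Prop :=
  ∀ (p : Θ) (δ : ℝ), 0 < δ → ∃ u : Θ, IsGreatest {q : Θ | d p q ≤ (δ : EReal)} u

/-- `d(·, q)` is continuous from the right at every `p < q`. -/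
def RightContinuousLeft (d : Θ → Θ → EReal) : Prop :=
  ∀ p q : Θ, p < q → ContinuousWithinAt (fun p' : Θ => d p' q) (Set.Ioi p) p

/-! ### The bandit model

Rounds are `t = 1, 2, …`; values of processes at `t = 0` and `X a 0` are never used. -/

section Model

variable {K : ℕ} {Ω : Type*}

/-- `N_a(t)`: the number of rounds `s ∈ {1, …, t}` in which arm `a` is played. -/
def pulls (A : ℕ → Ω → Fin K) (a : Fin K) (t : ℕ) (ω : Ω) : ℕ :=
  ((Finset.Icc 1 t).filter (fun s => A s ω = a)).card

/-- The reward received in round `t`, i.e. `X_{A_t, N_{A_t}(t)}`. -/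
def reward (X : Fin K → ℕ → Ω → Θ) (A : ℕ → Ω → Fin K) (t : ℕ) (ω : Ω) : Θ :=
  X (A t ω) (pulls A (A t ω) t ω) ω

/-- The sum of the rewards received from arm `a` up to round `t`. -/
def armSum (X : Fin K → ℕ → Ω → Θ) (A : ℕ → Ω → Fin K) (a : Fin K) (t : ℕ) (ω : Ω) : ℝ :=
  ∑ s ∈ (Finset.Icc 1 t).filter (fun s => A s ω = a), (reward X A s ω : ℝ)

theorem armSum_div_mem (X : Fin K → ℕ → Ω → Θ) (A : ℕ → Ω → Fin K) (a : Fin K) (t : ℕ) (ω : Ω) :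
    armSum X A a t ω / (pulls A a t ω : ℝ) ∈ Set.Icc (0 : ℝ) 1 := by
  have h0 : 0 ≤ armSum X A a t ω := Finset.sum_nonneg fun s _ => (reward X A s ω).2.1
  have h1 : armSum X A a t ω ≤ (pulls A a t ω : ℝ) := by
    unfold armSum pulls
    calc _ ≤ ∑ s ∈ (Finset.Icc 1 t).filter (fun s => A s ω = a), (1 : ℝ) :=
          Finset.sum_le_sum fun s _ => (reward X A s ω).2.2
      _ = _ := by simp
  exact ⟨div_nonneg h0 (Nat.cast_nonneg _), div_le_one_of_le₀ h1 (Nat.cast_nonneg _)⟩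

/-- The empirical mean of arm `a` based on the observations up to round `t`. -/
noncomputable def empMean (X : Fin K → ℕ → Ω → Θ) (A : ℕ → Ω → Fin K) (a : Fin K) (t : ℕ)
    (ω : Ω) : Θ :=
  ⟨armSum X A a t ω / (pulls A a t ω : ℝ), armSum_div_mem X A a t ω⟩

theorem integral_mem (ν : ProbabilityMeasure Θ) :
    ∫ x : Θ, (x : ℝ) ∂(ν : Measure Θ) ∈ Set.Icc (0 : ℝ) 1 := by
  refine ⟨integral_nonneg fun x => x.2.1, ?_⟩
  calc ∫ x : Θ, (x : ℝ) ∂(ν : Measure Θ) ≤ ∫ _x : Θ, (1 : ℝ) ∂(ν : Measure Θ) :=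
        integral_mono_of_nonneg (Eventually.of_forall fun x => x.2.1) (integrable_const _)
          (Eventually.of_forall fun x => x.2.2)
    _ = 1 := by simp

/-- The expectation `μ_a` of a reward distribution on `Θ`. -/
noncomputable def armMean (ν : ProbabilityMeasure Θ) : Θ :=
  ⟨∫ x : Θ, (x : ℝ) ∂(ν : Measure Θ), integral_mem ν⟩

/-- The largest expectation `μ*`. -/
noncomputable def bestMean (ν : Fin K → ProbabilityMeasure Θ) : Θ :=
  Finset.univ.sup fun a => armMean (ν a)

variable [MeasurableSpace Ω]

/-- The rewards `X a n` are independent random variables, and `X a n` has law `ν a`. -/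
structure IsRewardTable (P : Measure Ω) (ν : Fin K → ProbabilityMeasure Θ)
    (X : Fin K → ℕ → Ω → Θ) : Prop where
  measurable : ∀ a n, Measurable (X a n)
  law : ∀ a n, P.map (X a n) = (ν a : Measure Θ)
  indep : iIndepFun (fun (i : Fin K × ℕ) => X i.1 i.2) P

/-- The action in every round is a measurable function of the past actions and observed rewards
and of a random seed `ξ` which is independent of all the rewards. -/
structure IsAdmissible {S : Type*} [MeasurableSpace S] (P : Measure Ω)
    (X : Fin K → ℕ → Ω → Θ) (ξ : Ω → S) (A : ℕ → Ω → Fin K) : Prop where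
  measurable_seed : Measurable ξ
  indep_seed : IndepFun ξ (fun ω (i : Fin K × ℕ) => X i.1 i.2 ω) P
  nonanticipating : ∀ t : ℕ, ∃ f : S × (Fin t → Fin K × Θ) → Fin K, Measurable f ∧
    ∀ ω, A (t + 1) ω = f (ξ ω, fun s : Fin t => (A (s + 1) ω, reward X A (s + 1) ω))

/-- The expected regret `E[T μ* - ∑_{t ≤ T} X_{A_t, N_{A_t}(t)}]`. -/
noncomputable def regret (P : Measure Ω) (ν : Fin K → ProbabilityMeasure Θ)
    (X : Fin K → ℕ → Ω → Θ) (A : ℕ → Ω → Fin K) (T : ℕ) : ℝ :=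
  ∫ ω, ((T : ℝ) * (bestMean ν : ℝ) - ∑ t ∈ Finset.Icc 1 T, (reward X A t ω : ℝ)) ∂P

end Model

/-! ### The algorithm -/

/-- The UCB(`d`) index `max {q ∈ Θ : N d(p,q) ≤ log t + c log log t}`. -/
noncomputable def ucbIndex (d : Θ → Θ → EReal) (c : ℝ) (p : Θ) (N t : ℕ) : ℝ :=
  sSup ((fun q : Θ => (q : ℝ)) ''
    {q : Θ | (N : EReal) * d p q ≤ ((Real.log t + c * Real.log (Real.log t) : ℝ) : EReal)})

/-- The UCBoost(`D`) index: the minimum over `d ∈ D` of the UCB(`d`) indices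
(the infimum, if `D` is infinite). -/
noncomputable def boostIndex (D : Set (Θ → Θ → EReal)) (c : ℝ) (p : Θ) (N t : ℕ) : ℝ :=
  sInf ((fun d => ucbIndex d c p N t) '' D)

/-- The actions follow UCBoost(`D`): play each arm once in rounds `1, …, K`, and afterwards any
arm with the largest index. Ties may be broken in any way. -/
structure FollowsUCBoost {K : ℕ} {Ω : Type*} (D : Set (Θ → Θ → EReal)) (c : ℝ)
    (X : Fin K → ℕ → Ω → Θ) (A : ℕ → Ω → Fin K) : Prop where
  init : ∀ (t : ℕ) (ω : Ω), 1 ≤ t → t ≤ K → (A t ω : ℕ) + 1 = t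
  argmax : ∀ (t : ℕ) (ω : Ω), K + 1 ≤ t → ∀ b : Fin K,
    boostIndex D c (empMean X A b (t - 1) ω) (pulls A b (t - 1) ω) t ≤
      boostIndex D c (empMean X A (A t ω) (t - 1) ω) (pulls A (A t ω) (t - 1) ω) t

end UCBoost

/-! By independence the regret is `∑ Δ_a E[N_a(T)]` (`regret_eq_sum`), so it suffices to bound the
plays of one suboptimal arm `a`. Fix an optimal arm `b`, `q = μ*`, and a point `p` slightly above
`μ_a` with `c < max_d d(p, q)`; right continuity provides such `p` for every `c < max_d d(μ_a, q)`.

If `a` is played, then either the index of `b` is below `q`, or the index of `a` is at least `q`. In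
the first case kl-domination forces the empirical mean of `b` to be far below `q` in Bernoulli
divergence. In the second, some `d ∈ D` nearly attains the maximum, and its index being at least `q`
leaves two possibilities: the empirical mean of `a` exceeds `p`, or `a` has at most `bonus / c`
observations (`play_cases`).

The last possibility costs `bonus T / c + 1` plays, asymptotically `log T / c`. Overestimation costs
`O(1)` by Hoeffding. Underestimation at time `t` has probability `O(1 / (t log t))`, which sums to
`o(log T)`. That bound comes from peeling the sample size geometrically and applying Doob's
inequality in each slice to a product of likelihood ratios. The ratio is extended affinely from `{0,
1}` to `[0, 1]`, so it keeps mean one under any law of mean `q`, and concavity of the logarithm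
makes it as effective as for Bernoulli rewards. Finally `c` increases to `max_d d(μ_a, q)`. -/

open MeasureTheory ProbabilityTheory Filter Topology

namespace UCBoost

/-! ### The Bernoulli divergence -/

/-- Real version of `dkl p q`, for `0 < q < 1`. -/
noncomputable def binKL (p q : ℝ) : ℝ :=
  -Real.binEntropy p - p * Real.log q - (1 - p) * Real.log (1 - q)

theorem mul_log_div (x y : ℝ) (hy : y ≠ 0) :
    x * Real.log (x / y) = -(x * Real.log x⁻¹) - x * Real.log y := by
  rcases eq_or_ne x 0 with rfl | hx
  · simp
  · rw [Real.log_div hx hy, Real.log_inv]; ring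

theorem klTerm_eq_coe (x y : ℝ) (hy : y ≠ 0) :
    klTerm x y = ((-(x * Real.log x⁻¹) - x * Real.log y : ℝ) : EReal) := by
  unfold klTerm
  rw [← mul_log_div x y hy]
  split_ifs with h
  · simp [h]
  · rfl

theorem dkl_eq_coe (p q : Θ) (h0 : (0 : ℝ) < q) (h1 : (q : ℝ) < 1) :
    dkl p q = ((binKL p q : ℝ) : EReal) := by
  unfold dkl
  rw [klTerm_eq_coe _ _ h0.ne', klTerm_eq_coe _ _ (sub_pos.2 h1).ne', ← EReal.coe_add]
  congr 1
  unfold binKL Real.binEntropy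
  ring

theorem continuous_binKL_left (q : ℝ) : Continuous fun p => binKL p q := by
  unfold binKL
  have := Real.binEntropy_continuous
  fun_prop

theorem binKL_self (q : ℝ) : binKL q q = 0 := by
  unfold binKL Real.binEntropy
  rw [Real.log_inv, Real.log_inv]; ring

/-- Negative binary entropy is convex, and the remaining terms are affine in `p`. -/
theorem convexOn_binKL_left (q : ℝ) : ConvexOn ℝ (Set.Icc 0 1) fun p => binKL p q := by
  have h1 : ConvexOn ℝ (Set.Icc 0 1) fun p => -Real.binEntropy p :=
    Real.strictConcave_binEntropy.concaveOn.neg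
  have h2 : ConvexOn ℝ (Set.Icc (0 : ℝ) 1) fun p => -(p * Real.log q) - (1 - p) * Real.log (1 - q) := by
    refine ⟨convex_Icc _ _, fun x _ y _ a b _ _ hab => le_of_eq ?_⟩
    simp only [smul_eq_mul]
    linear_combination (Real.log (1 - q)) * hab
  refine (h1.add h2).congr fun x _ => ?_
  simp only [Pi.add_apply, binKL]
  ring

/-- On `[0, q]` the sublevel sets of `binKL · q` are intervals with right end point `q`. -/
theorem binKL_le_of_mem_Icc {z x q : ℝ} (hz : 0 ≤ z) (hzx : z ≤ x) (hxq : x ≤ q) (hq : q ≤ 1)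
    (h : 0 ≤ binKL z q) : binKL x q ≤ binKL z q := by
  have := (convexOn_binKL_left q).le_max_of_mem_Icc (x := z) (y := q) (z := x)
    ⟨hz, by linarith⟩ ⟨by linarith, hq⟩ ⟨hzx, hxq⟩
  rwa [binKL_self, max_eq_left h] at this

/-- The likelihood ratio of the Bernoulli laws with means `z` and `q`, extended affinely. -/
noncomputable def bernRatio (z q x : ℝ) : ℝ := x * (z / q) + (1 - x) * ((1 - z) / (1 - q))

/-- Jensen for the logarithm: `bernRatio` averages the two Bernoulli likelihood ratios with weights
`x` and `1 - x`. -/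
theorem log_bernRatio_ge {z q x : ℝ} (hz0 : 0 < z) (hz1 : z < 1) (hq0 : 0 < q) (hq1 : q < 1)
    (hx0 : 0 ≤ x) (hx1 : x ≤ 1) :
    x * Real.log (z / q) + (1 - x) * Real.log ((1 - z) / (1 - q)) ≤
      Real.log (bernRatio z q x) := by
  have := strictConcaveOn_log_Ioi.concaveOn.2 (x := z / q) (y := (1 - z) / (1 - q))
    (div_pos hz0 hq0) (div_pos (sub_pos.2 hz1) (sub_pos.2 hq1)) hx0 (sub_nonneg.2 hx1) (by ring)
  simpa [bernRatio] using this

theorem bernRatio_pos {z q x : ℝ} (hz0 : 0 < z) (hz1 : z < 1) (hq0 : 0 < q) (hq1 : q < 1)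
    (hx0 : 0 ≤ x) (hx1 : x ≤ 1) : 0 < bernRatio z q x := by
  have h1 : 0 < z / q := div_pos hz0 hq0
  have h2 : 0 < (1 - z) / (1 - q) := div_pos (by linarith) (by linarith)
  unfold bernRatio
  rcases hx0.eq_or_lt with rfl | h
  · simpa using h2
  · have := mul_nonneg (sub_nonneg.2 hx1) h2.le
    have := mul_pos h h1
    linarith

/-- Below `z`, the product of the likelihood ratios is at least `exp (n * binKL z q)`. -/
theorem exp_le_prod_bernRatio {z q : ℝ} (hz0 : 0 < z) (hzq : z < q) (hq1 : q < 1)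
    {x : ℕ → ℝ} (hx : ∀ i, x i ∈ Set.Icc (0 : ℝ) 1) {n : ℕ}
    (hs : ∑ i ∈ Finset.range n, x i ≤ n * z) :
    Real.exp (n * binKL z q) ≤ ∏ i ∈ Finset.range n, bernRatio z q (x i) := by
  have hq0 : 0 < q := hz0.trans hzq
  have hz1 : z < 1 := hzq.trans hq1
  have hpos : ∀ i ∈ Finset.range n, 0 < bernRatio z q (x i) := fun i _ =>
    bernRatio_pos hz0 hz1 hq0 hq1 (hx i).1 (hx i).2
  rw [← Real.exp_log (Finset.prod_pos hpos), Real.exp_le_exp, Real.log_prod fun i hi => (hpos i hi).ne']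
  refine le_trans ?_ (Finset.sum_le_sum fun i _ =>
    log_bernRatio_ge hz0 hz1 hq0 hq1 (hx i).1 (hx i).2)
  -- The lower bound on the log-product is affine in `∑ x i`, with slope `log (z/q) - log
  -- ((1-z)/(1-q)) ≤ 0`, so it is smallest at `∑ x i = n z`, where it equals `n * binKL z q`.
  have e1 : Real.log (z / q) ≤ 0 := Real.log_nonpos (by positivity) ((div_le_one hq0).2 hzq.le)
  have e2 : 0 ≤ Real.log ((1 - z) / (1 - q)) :=
    Real.log_nonneg ((one_le_div (by linarith)).2 (by linarith))
  have e3 : binKL z q = z * Real.log (z / q) + (1 - z) * Real.log ((1 - z) / (1 - q)) := by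
    rw [mul_log_div _ _ hq0.ne', mul_log_div _ _ (sub_pos.2 hq1).ne', binKL, Real.binEntropy]
    ring
  rw [Finset.sum_add_distrib, ← Finset.sum_mul, ← Finset.sum_mul, Finset.sum_sub_distrib, e3]
  simp only [Finset.sum_const, Finset.card_range, nsmul_eq_mul, mul_one]
  nlinarith [mul_nonneg (sub_nonneg.2 hs) (sub_nonneg.2 (e1.trans e2))]

/-! ### A maximal inequality for products of independent variables with mean one -/

section Maximal

variable {Ω : Type*}

theorem prod_range_mem_Icc {Y : ℕ → Ω → ℝ} {C : ℝ} (h0 : ∀ i ω, 0 ≤ Y i ω)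
    (hC : ∀ i ω, Y i ω ≤ C) (n : ℕ) (ω : Ω) :
    ∏ i ∈ Finset.range n, Y i ω ∈ Set.Icc 0 (C ^ n) := by
  refine ⟨Finset.prod_nonneg fun i _ => h0 i ω, ?_⟩
  calc _ ≤ ∏ i ∈ Finset.range n, C := Finset.prod_le_prod (fun i _ => h0 i ω) fun i _ => hC i ω
    _ = _ := by simp

variable [MeasurableSpace Ω] {P : Measure Ω}

/-- The next factor is independent of the past and has mean one. Time `n` carries `n + 1` factors,
to match the natural filtration, which already knows `Y n` at time `n`. -/
theorem martingale_prod [IsProbabilityMeasure P] {Y : ℕ → Ω → ℝ} {C : ℝ}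
    (hm : ∀ i, Measurable (Y i)) (hi : iIndepFun Y P) (h0 : ∀ i ω, 0 ≤ Y i ω)
    (hC : ∀ i ω, Y i ω ≤ C) (h1 : ∀ i, ∫ ω, Y i ω ∂P = 1) :
    Martingale (fun n ω => ∏ i ∈ Finset.range (n + 1), Y i ω)
      (Filtration.natural Y fun i => (hm i).stronglyMeasurable) P := by
  set F := Filtration.natural Y fun i => (hm i).stronglyMeasurable with hF
  have hint : ∀ n, Integrable (fun ω => ∏ i ∈ Finset.range n, Y i ω) P := fun n =>
    Integrable.of_mem_Icc 0 (C ^ n)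
      (Finset.measurable_prod _ fun i _ => hm i).aemeasurable
      (Eventually.of_forall fun ω => prod_range_mem_Icc h0 hC n ω)
  have hY : ∀ i, Integrable (Y i) P := fun i =>
    Integrable.of_mem_Icc 0 C (hm i).aemeasurable (Eventually.of_forall fun ω => ⟨h0 i ω, hC i ω⟩)
  have had : StronglyAdapted F (fun n ω => ∏ i ∈ Finset.range (n + 1), Y i ω) := by
    intro n
    refine Finset.stronglyMeasurable_fun_prod _ fun i hi => ?_
    exact (Filtration.stronglyAdapted_natural (fun i => (hm i).stronglyMeasurable) i).mono
      (F.mono (Nat.lt_succ_iff.1 (Finset.mem_range.1 hi)))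
  refine martingale_nat had (fun n => hint (n + 1)) fun n => ?_
  have e : (fun ω => ∏ i ∈ Finset.range (n + 1 + 1), Y i ω) =
      (fun ω => ∏ i ∈ Finset.range (n + 1), Y i ω) * Y (n + 1) := by
    ext ω; rw [Finset.prod_range_succ]; rfl
  have h2 := condExp_mul_of_stronglyMeasurable_left (μ := P) (had n) (e ▸ hint (n + 2))
    (hY (n + 1))
  have h3 := hi.condExp_natural_ae_eq_of_lt (fun i => (hm i).stronglyMeasurable) (Nat.lt_succ_self n)
  simp only [e]
  filter_upwards [h2, h3] with ω w2 w3
  rw [w2, Pi.mul_apply, w3, h1, mul_one]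

/-- Doob's maximal inequality; the bound is free of `t` because the martingale keeps expectation
one. -/
theorem measureReal_exists_prod_ge_le [IsProbabilityMeasure P] {Y : ℕ → Ω → ℝ} {C : ℝ}
    (hm : ∀ i, Measurable (Y i)) (hi : iIndepFun Y P) (h0 : ∀ i ω, 0 ≤ Y i ω)
    (hC : ∀ i ω, Y i ω ≤ C) (h1 : ∀ i, ∫ ω, Y i ω ∂P = 1) {s : ℝ} (hs : 0 < s) (t : ℕ) :
    P.real {ω | ∃ n, 1 ≤ n ∧ n ≤ t ∧ s ≤ ∏ i ∈ Finset.range n, Y i ω} ≤ s⁻¹ := by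
  have hmart := martingale_prod hm hi h0 hC h1
  set M : ℕ → Ω → ℝ := fun n ω => ∏ i ∈ Finset.range (n + 1), Y i ω with hM
  have hnn : 0 ≤ M := fun n ω => Finset.prod_nonneg fun i _ => h0 i ω
  have hE : ∫ ω, M t ω ∂P = 1 := by
    have := hmart.setIntegral_eq (Nat.zero_le t) MeasurableSet.univ
    simp only [setIntegral_univ] at this
    rw [← this]
    simpa [hM] using h1 0
  have key := maximal_ineq hmart.submartingale hnn (ε := s.toNNReal) t
  set E := {ω | (s.toNNReal : ℝ) ≤ (Finset.range (t + 1)).sup' Finset.nonempty_range_add_one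
    fun k => M k ω}
  have hsub : {ω | ∃ n, 1 ≤ n ∧ n ≤ t ∧ s ≤ ∏ i ∈ Finset.range n, Y i ω} ⊆ E := by
    rintro ω ⟨n, hn, hnt, h⟩
    obtain ⟨m, rfl⟩ := Nat.exists_eq_add_of_le' hn
    simp only [E, Set.mem_ofPred_eq, Real.coe_toNNReal _ hs.le]
    exact h.trans (Finset.le_sup' (fun k => M k ω) (Finset.mem_range.2 (by omega)))
  have hle : ∫ ω in E, M t ω ∂P ≤ 1 := by
    rw [← hE]
    exact setIntegral_le_integral (hmart.integrable t) (Eventually.of_forall fun ω => hnn t ω)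
  have h4 : (s.toNNReal : ENNReal) * P E ≤ 1 := by
    refine key.trans ?_
    rw [← ENNReal.ofReal_one]
    exact ENNReal.ofReal_le_ofReal hle
  have h5 : s * P.real E ≤ 1 := by
    have := ENNReal.toReal_mono ENNReal.one_ne_top h4
    simpa [ENNReal.toReal_mul, Measure.real, hs.le] using this
  calc _ ≤ P.real E := measureReal_mono hsub
    _ ≤ s⁻¹ := by rwa [← one_div, le_div_iff₀' hs]

/-- One slice of the peeling argument. -/
theorem measureReal_slice_le [IsProbabilityMeasure P] {Y : ℕ → Ω → ℝ} {q : ℝ}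
    (hm : ∀ i, Measurable (Y i)) (hi : iIndepFun Y P) (hY : ∀ i ω, Y i ω ∈ Set.Icc (0 : ℝ) 1)
    (hE : ∀ i, ∫ ω, Y i ω ∂P = q) (hq0 : 0 < q) (hq1 : q < 1) {δ γ m : ℝ} (hδ : 0 < δ)
    (hγ : 1 < γ) (hm0 : 0 < m) (t : ℕ) :
    P.real {ω | ∃ n : ℕ, 1 ≤ n ∧ n ≤ t ∧ m ≤ n ∧ n ≤ γ * m ∧
      ∑ i ∈ Finset.range n, Y i ω < n * q ∧
      δ < n * binKL ((∑ i ∈ Finset.range n, Y i ω) / n) q} ≤ Real.exp (-(δ / γ)) := by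
  have hγ0 : 0 < γ := by linarith
  -- The level is chosen so that `n η ≤ δ` for every `n ≤ γ m`, while `n η ≥ δ / γ` for every `n ≥
  -- m`: one `z` with divergence `η` serves the whole slice.
  set η := δ / (γ * m) with hη
  have hη0 : 0 < η := by positivity
  by_cases hz : ∃ z ∈ Set.Ioo 0 q, binKL z q = η
  · obtain ⟨z, ⟨hz0, hzq⟩, hzη⟩ := hz
    have hz1 : z < 1 := hzq.trans hq1
    have hpos : ∀ i ω, 0 < bernRatio z q (Y i ω) := fun i ω =>
      bernRatio_pos hz0 hz1 hq0 hq1 (hY i ω).1 (hY i ω).2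
    have hr1 : 0 < z / q := div_pos hz0 hq0
    have hr2 : 0 < (1 - z) / (1 - q) := div_pos (sub_pos.2 hz1) (sub_pos.2 hq1)
    have hmeas : Measurable fun x : ℝ => bernRatio z q x := by
      unfold bernRatio; fun_prop
    have hint : ∀ i, Integrable (Y i) P := fun i =>
      Integrable.of_mem_Icc 0 1 (hm i).aemeasurable (Eventually.of_forall fun ω => hY i ω)
    have hone : ∀ i, ∫ ω, bernRatio z q (Y i ω) ∂P = 1 := fun i => by
      unfold bernRatio
      have h2 : Integrable (fun ω => 1 - Y i ω) P := (integrable_const _).sub (hint i)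
      rw [integral_add ((hint i).mul_const _) (h2.mul_const _),
        integral_mul_const, integral_mul_const, integral_sub (integrable_const _) (hint i), hE]
      have : 1 - q ≠ 0 := (sub_pos.2 hq1).ne'
      simp
      field_simp
      ring
    have hmax := measureReal_exists_prod_ge_le (P := P) (Y := fun i ω => bernRatio z q (Y i ω))
      (C := z / q + (1 - z) / (1 - q)) (fun i => hmeas.comp (hm i))
      (hi.comp (fun _ => bernRatio z q) fun _ => hmeas) (fun i ω => (hpos i ω).le)
      (fun i ω => by
        have h1 := mul_le_mul_of_nonneg_right (hY i ω).2 hr1.le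
        have h2 := mul_nonneg (hY i ω).1 hr2.le
        unfold bernRatio
        linarith) hone (Real.exp_pos (δ / γ)) t
    rw [Real.exp_neg]
    refine (measureReal_mono ?_).trans hmax
    rintro ω ⟨n, hn1, hnt, hmn, hnm, hS, hkl⟩
    refine ⟨n, hn1, hnt, ?_⟩
    have hn0 : (0 : ℝ) < n := by exact_mod_cast hn1
    have hnη : (n : ℝ) * η ≤ δ := by
      rw [hη, ← mul_div_assoc, div_le_iff₀ (by positivity)]
      nlinarith
    -- A mean in `(z, q]` would have divergence at most `η`, hence `n` times it at most `δ`.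
    have hx : (∑ i ∈ Finset.range n, Y i ω) / n ≤ z := by
      by_contra! h
      have h1 := binKL_le_of_mem_Icc hz0.le h.le ((div_le_iff₀' hn0).2 hS.le) hq1.le
        (hzη ▸ hη0.le)
      rw [hzη] at h1
      have := mul_le_mul_of_nonneg_left h1 hn0.le
      linarith
    refine le_trans ?_ (exp_le_prod_bernRatio hz0 hzq hq1 (fun i => hY i ω)
      ((div_le_iff₀' hn0).1 hx))
    rw [Real.exp_le_exp, hzη]
    calc δ / γ = m * η := by rw [hη]; field_simp
      _ ≤ n * η := by gcongr
  -- If no `z` reaches level `η`, the event is empty: a mean in it has divergence above `η`, and the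
  -- intermediate value theorem would produce `z`.
  · refine le_trans (le_of_eq ?_) (Real.exp_pos _).le
    convert measureReal_empty (μ := P)
    rw [Set.eq_empty_iff_forall_notMem]
    rintro ω ⟨n, hn1, hnt, hmn, hnm, hS, hkl⟩
    apply hz
    have hn0 : (0 : ℝ) < n := by exact_mod_cast hn1
    set x := (∑ i ∈ Finset.range n, Y i ω) / n with hx
    have hx0 : 0 ≤ x := div_nonneg (Finset.sum_nonneg fun i _ => (hY i ω).1) hn0.le
    have hxq : x < q := (div_lt_iff₀' hn0).2 hS
    have hηx : η < binKL x q := by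
      rw [hη, div_lt_iff₀ (by positivity)]
      have : 0 < binKL x q := pos_of_mul_pos_right (hδ.trans hkl) hn0.le
      nlinarith
    obtain ⟨z, hz, hzη⟩ := intermediate_value_Ioo' hxq.le
      (continuous_binKL_left q).continuousOn (show η ∈ Set.Ioo (binKL q q) (binKL x q) from
        ⟨by rwa [binKL_self], hηx⟩)
    exact ⟨z, ⟨hx0.trans_lt hz.1, hz.2⟩, hzη⟩

/-- The self-normalized deviation inequality below the mean, by peeling with ratio `γ`. -/
theorem measureReal_exists_lower_deviation_le [IsProbabilityMeasure P] {Y : ℕ → Ω → ℝ} {q : ℝ}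
    (hm : ∀ i, Measurable (Y i)) (hi : iIndepFun Y P) (hY : ∀ i ω, Y i ω ∈ Set.Icc (0 : ℝ) 1)
    (hE : ∀ i, ∫ ω, Y i ω ∂P = q) (hq0 : 0 < q) (hq1 : q < 1) {δ γ : ℝ} (hδ : 0 < δ)
    (hγ : 1 < γ) {t : ℕ} (ht : 1 ≤ t) :
    P.real {ω | ∃ n : ℕ, 1 ≤ n ∧ n ≤ t ∧ ∑ i ∈ Finset.range n, Y i ω < n * q ∧
      δ < n * binKL ((∑ i ∈ Finset.range n, Y i ω) / n) q} ≤
      (Real.log t / Real.log γ + 1) * Real.exp (-(δ / γ)) := by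
  have hγ0 : 0 < γ := by linarith
  have hlog : 0 < Real.log γ := Real.log_pos hγ
  set L := ⌊Real.log t / Real.log γ⌋₊ with hL
  have hsub : {ω | ∃ n : ℕ, 1 ≤ n ∧ n ≤ t ∧ ∑ i ∈ Finset.range n, Y i ω < n * q ∧
      δ < n * binKL ((∑ i ∈ Finset.range n, Y i ω) / n) q} ⊆
      ⋃ k ∈ Finset.range (L + 1), {ω | ∃ n : ℕ, 1 ≤ n ∧ n ≤ t ∧ γ ^ k ≤ n ∧ n ≤ γ * γ ^ k ∧
      ∑ i ∈ Finset.range n, Y i ω < n * q ∧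
      δ < n * binKL ((∑ i ∈ Finset.range n, Y i ω) / n) q} := by
    rintro ω ⟨n, hn1, hnt, hS, hkl⟩
    have hn0 : (0 : ℝ) < n := by exact_mod_cast hn1
    have hn1' : (1 : ℝ) ≤ n := by exact_mod_cast hn1
    have hnt' : (n : ℝ) ≤ t := by exact_mod_cast hnt
    set k := ⌊Real.log n / Real.log γ⌋₊ with hk
    have hkL : k ≤ L := Nat.floor_le_floor
      (div_le_div_of_nonneg_right (Real.log_le_log hn0 hnt') hlog.le)
    refine Set.mem_biUnion (Finset.mem_coe.2 (Finset.mem_range.2 (Nat.lt_succ_of_le hkL)))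
      ⟨n, hn1, hnt, ?_, ?_, hS, hkl⟩
    · have := Nat.floor_le (div_nonneg (Real.log_nonneg hn1') hlog.le)
      rw [← hk, le_div_iff₀ hlog] at this
      rwa [← Real.log_le_log_iff (pow_pos hγ0 _) hn0, Real.log_pow]
    · have := (Nat.lt_floor_add_one (Real.log n / Real.log γ)).le
      rw [← hk, div_le_iff₀ hlog] at this
      rw [← pow_succ', ← Real.log_le_log_iff hn0 (pow_pos hγ0 _), Real.log_pow]
      exact_mod_cast this
  calc _ ≤ _ := measureReal_mono hsub (measure_ne_top _ _)
    _ ≤ _ := measureReal_biUnion_finset_le _ _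
    _ ≤ ∑ k ∈ Finset.range (L + 1), Real.exp (-(δ / γ)) := Finset.sum_le_sum fun k _ =>
      measureReal_slice_le hm hi hY hE hq0 hq1 hδ hγ (pow_pos hγ0 k) t
    _ = (L + 1) * Real.exp (-(δ / γ)) := by simp
    _ ≤ _ := by
      gcongr
      exact Nat.floor_le (div_nonneg (Real.log_nonneg (by exact_mod_cast ht)) hlog.le)

end Maximal

/-! ### The history as a functional of the seed and the reward table -/

section History

variable {K : ℕ} {S : Type*}

/-- The number of times arm `a` occurs in a history. -/
def histCount {t : ℕ} (h : Fin t → Fin K × Θ) (a : Fin K) : ℕ :=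
  ∑ i, if (h i).1 = a then 1 else 0

theorem histCount_snoc {t : ℕ} (h : Fin t → Fin K × Θ) (p : Fin K × Θ) (a : Fin K) :
    histCount (Fin.snoc (α := fun _ => Fin K × Θ) h p) a =
      histCount h a + if p.1 = a then 1 else 0 := by
  unfold histCount
  rw [Fin.sum_univ_castSucc]
  simp

/-- The history produced by the policy `f` from the seed `s` and the reward table `x`. -/
def history (f : ∀ t : ℕ, S × (Fin t → Fin K × Θ) → Fin K) (s : S) (x : Fin K × ℕ → Θ) :
    ∀ t : ℕ, Fin t → Fin K × Θ
  | 0 => Fin.elim0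
  | t + 1 => Fin.snoc (α := fun _ => Fin K × Θ) (history f s x t)
      (f t (s, history f s x t), x (f t (s, history f s x t),
        histCount (history f s x t) (f t (s, history f s x t)) + 1))

/-- The history does not depend on the entry `(a, n)` of the table, as long as arm `a` was
played less than `n` times. -/
theorem history_congr (f : ∀ t : ℕ, S × (Fin t → Fin K × Θ) → Fin K) (s : S)
    {x x' : Fin K × ℕ → Θ} {a : Fin K} {n : ℕ} (hx : ∀ i, i ≠ (a, n) → x i = x' i) (t : ℕ)
    (h : histCount (history f s x t) a < n) : history f s x t = history f s x' t := by
  induction t with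
  | zero => rfl
  | succ t ih =>
    rw [history, histCount_snoc] at h
    have e := ih (lt_of_le_of_lt (Nat.le_add_right _ _) h)
    simp only [history]
    rw [← e]
    congr 2
    -- Reading entry `(a, n)` in this round would bring the count of `a` up to `n`, against `h`.
    refine hx _ fun h' => ?_
    obtain ⟨h1, h2⟩ := Prod.mk.inj h'
    simp only [h1, if_true] at h h2
    omega

variable [MeasurableSpace S]

theorem measurable_histCount {t : ℕ} (a : Fin K) :
    Measurable fun h : Fin t → Fin K × Θ => histCount h a := by
  unfold histCount
  refine Finset.measurable_sum _ fun i _ => Measurable.ite ?_ measurable_const measurable_const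
  exact (measurable_fst.comp (measurable_pi_apply i)) (measurableSet_singleton a)

theorem measurable_history {f : ∀ t : ℕ, S × (Fin t → Fin K × Θ) → Fin K}
    (hf : ∀ t, Measurable (f t)) (t : ℕ) :
    Measurable fun p : S × (Fin K × ℕ → Θ) => history f p.1 p.2 t := by
  induction t with
  | zero => exact measurable_pi_lambda _ fun i => i.elim0
  | succ t ih =>
    have hact : Measurable fun p : S × (Fin K × ℕ → Θ) => f t (p.1, history f p.1 p.2 t) :=
      (hf t).comp (measurable_fst.prodMk ih)
    have hcnt : Measurable fun p : S × (Fin K × ℕ → Θ) =>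
        histCount (history f p.1 p.2 t) (f t (p.1, history f p.1 p.2 t)) := by
      have : Measurable fun p : (Fin t → Fin K × Θ) × Fin K => histCount p.1 p.2 :=
        measurable_from_prod_countable_left fun a => measurable_histCount a
      exact this.comp (ih.prodMk hact)
    have heval : Measurable fun p : (Fin K × ℕ → Θ) × (Fin K × ℕ) => p.1 p.2 :=
      measurable_from_prod_countable_left fun i => measurable_pi_apply i
    refine measurable_pi_lambda _ fun i => ?_
    refine Fin.lastCases ?_ (fun j => ?_) i
    · simp only [history, Fin.snoc_last]
      exact hact.prodMk (heval.comp (measurable_snd.prodMk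
        (hact.prodMk (hcnt.add measurable_const))))
    · simp only [history, Fin.snoc_castSucc]
      exact (measurable_pi_apply j).comp ih

end History

/-! ### Play counts, and the actual run as a history. -/

section Counts

variable {K : ℕ} {Ω : Type*}

theorem pulls_zero (A : ℕ → Ω → Fin K) (a : Fin K) (ω : Ω) : pulls A a 0 ω = 0 := by
  simp [pulls]

theorem pulls_succ (A : ℕ → Ω → Fin K) (a : Fin K) (t : ℕ) (ω : Ω) :
    pulls A a (t + 1) ω = pulls A a t ω + if A (t + 1) ω = a then 1 else 0 := by
  unfold pulls
  rw [Finset.card_filter, Finset.card_filter, Finset.sum_Icc_succ_top (by omega)]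

theorem pulls_le (A : ℕ → Ω → Fin K) (a : Fin K) (t : ℕ) (ω : Ω) : pulls A a t ω ≤ t := by
  unfold pulls
  exact (Finset.card_filter_le _ _).trans (by simp)

theorem pulls_mono (A : ℕ → Ω → Fin K) (a : Fin K) (ω : Ω) :
    Monotone fun t => pulls A a t ω :=
  monotone_nat_of_le_succ fun t => by rw [pulls_succ]; exact Nat.le_add_right _ _

/-- The `n`-th play of `a` reads entry `n` of its row. Rows start at entry 1, hence the shift `i +
1`. -/
theorem armSum_eq_sum (X : Fin K → ℕ → Ω → Θ) (A : ℕ → Ω → Fin K) (a : Fin K) (t : ℕ) (ω : Ω) :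
    armSum X A a t ω = ∑ i ∈ Finset.range (pulls A a t ω), (X a (i + 1) ω : ℝ) := by
  induction t with
  | zero => simp [armSum, pulls]
  | succ t ih =>
    have e : armSum X A a (t + 1) ω =
        armSum X A a t ω + if A (t + 1) ω = a then (reward X A (t + 1) ω : ℝ) else 0 := by
      unfold armSum
      rw [Finset.sum_filter, Finset.sum_filter, Finset.sum_Icc_succ_top (by omega)]
    rw [e, ih, pulls_succ]
    split_ifs with h
    · rw [Finset.sum_range_succ]
      subst h
      simp [reward, pulls_succ]
    · simp

/-- The random number of plays is moved into indicators over a deterministic range, so that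
expectations can be taken term by term. -/
theorem sum_reward_eq (X : Fin K → ℕ → Ω → Θ) (A : ℕ → Ω → Fin K) (T : ℕ) (ω : Ω) :
    ∑ t ∈ Finset.Icc 1 T, (reward X A t ω : ℝ) =
      ∑ a, ∑ i ∈ Finset.range T, if i < pulls A a T ω then (X a (i + 1) ω : ℝ) else 0 := by
  rw [← Finset.sum_fiberwise (Finset.Icc 1 T) (fun t => A t ω)]
  refine Finset.sum_congr rfl fun a _ => ?_
  refine (armSum_eq_sum X A a T ω).trans ?_
  rw [← Finset.sum_filter]
  refine Finset.sum_congr ?_ fun _ _ => rfl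
  have := pulls_le A a T ω
  ext i
  simp only [Finset.mem_range, Finset.mem_filter]
  omega

theorem sum_pulls (A : ℕ → Ω → Fin K) (T : ℕ) (ω : Ω) : ∑ a, pulls A a T ω = T := by
  unfold pulls
  rw [← Finset.card_eq_sum_card_fiberwise (fun _ _ => Finset.mem_coe.2 (Finset.mem_univ _))]
  simp

theorem history_eq {S : Type*} {X : Fin K → ℕ → Ω → Θ} {A : ℕ → Ω → Fin K} {ξ : Ω → S}
    {f : ∀ t : ℕ, S × (Fin t → Fin K × Θ) → Fin K}
    (hf : ∀ t ω, A (t + 1) ω = f t (ξ ω, fun s : Fin t => (A (s + 1) ω, reward X A (s + 1) ω)))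
    (t : ℕ) (ω : Ω) : history f (ξ ω) (fun i => X i.1 i.2 ω) t =
      fun s : Fin t => (A (s + 1) ω, reward X A (s + 1) ω) := by
  have hc : ∀ (t : ℕ) (a : Fin K),
      histCount (fun s : Fin t => (A (s + 1) ω, reward X A (s + 1) ω)) a = pulls A a t ω := by
    intro t a
    unfold histCount
    rw [Fin.sum_univ_eq_sum_range (fun s => if A (s + 1) ω = a then 1 else 0) t]
    induction t with
    | zero => simp [pulls_zero]
    | succ t ih => rw [Finset.sum_range_succ, ih, pulls_succ]
  induction t with
  | zero => funext i; exact i.elim0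
  | succ t ih =>
    simp only [history, ih, ← hf, hc]
    funext i
    refine Fin.lastCases ?_ (fun j => ?_) i
    · simp [reward, pulls_succ]
    · simp

theorem histCount_history {S : Type*} {X : Fin K → ℕ → Ω → Θ} {A : ℕ → Ω → Fin K} {ξ : Ω → S}
    {f : ∀ t : ℕ, S × (Fin t → Fin K × Θ) → Fin K}
    (hf : ∀ t ω, A (t + 1) ω = f t (ξ ω, fun s : Fin t => (A (s + 1) ω, reward X A (s + 1) ω)))
    (t : ℕ) (ω : Ω) (a : Fin K) :
    histCount (history f (ξ ω) (fun i => X i.1 i.2 ω) t) a = pulls A a t ω := by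
  induction t with
  | zero => simp [histCount, pulls_zero]
  | succ t ih =>
    rw [history, histCount_snoc, ih, pulls_succ, history_eq hf, ← hf]

end Counts

/-! ### Independence and the regret decomposition -/

section Decomposition

variable {K : ℕ} {Ω : Type*} [MeasurableSpace Ω] {P : Measure Ω}

/-- The two hypotheses make the joint law of `Z`, `U`, `V` a triple product; associativity of the
product measure regroups it. -/
theorem indepFun_prodMk_of_indepFun [IsProbabilityMeasure P] {α β γ : Type*} [MeasurableSpace α] [MeasurableSpace β]
    [MeasurableSpace γ] {Z : Ω → α} {U : Ω → β} {V : Ω → γ} (hZ : Measurable Z)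
    (hU : Measurable U) (hV : Measurable V) (h1 : IndepFun U (fun ω => (Z ω, V ω)) P)
    (h2 : IndepFun Z V P) : IndepFun Z (fun ω => (U ω, V ω)) P := by
  have hUV : IndepFun U V P := h1.comp measurable_id measurable_snd
  have : IsProbabilityMeasure (P.map Z) := Measure.isProbabilityMeasure_map hZ.aemeasurable
  have : IsProbabilityMeasure (P.map U) := Measure.isProbabilityMeasure_map hU.aemeasurable
  have : IsProbabilityMeasure (P.map V) := Measure.isProbabilityMeasure_map hV.aemeasurable
  rw [indepFun_iff_map_prod_eq_prod_map_map hZ.aemeasurable (hU.prodMk hV).aemeasurable,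
    hUV.map_prod_eq_prod_map_map hU.aemeasurable hV.aemeasurable]
  have hUZ : IndepFun U Z P := h1.comp measurable_id measurable_fst
  have hUZV : IndepFun (fun ω => (U ω, Z ω)) V P := by
    rw [indepFun_iff_map_prod_eq_prod_map_map (hU.prodMk hZ).aemeasurable hV.aemeasurable,
      hUZ.map_prod_eq_prod_map_map hU.aemeasurable hZ.aemeasurable,
      ← MeasurableEquiv.prodAssoc.map_measurableEquiv_injective.eq_iff, Measure.prodAssoc_prod,
      Measure.map_map MeasurableEquiv.prodAssoc.measurable ((hU.prodMk hZ).prodMk hV),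
      ← h2.map_prod_eq_prod_map_map hZ.aemeasurable hV.aemeasurable]
    exact h1.map_prod_eq_prod_map_map hU.aemeasurable (hZ.prodMk hV).aemeasurable
  have hZUV : IndepFun (fun ω => (Z ω, U ω)) V P := hUZV.comp measurable_swap measurable_id
  rw [← Measure.prodAssoc_prod, ← hUZ.symm.map_prod_eq_prod_map_map hZ.aemeasurable hU.aemeasurable,
    ← hZUV.map_prod_eq_prod_map_map (hZ.prodMk hU).aemeasurable hV.aemeasurable,
    Measure.map_map MeasurableEquiv.prodAssoc.measurable ((hZ.prodMk hU).prodMk hV)]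
  rfl

/-- With entry `(a, n)` overwritten by a constant, the table is a function of the other entries
only. -/
theorem IsRewardTable.indepFun_update {ν : Fin K → ProbabilityMeasure Θ}
    {X : Fin K → ℕ → Ω → Θ} (hX : IsRewardTable P ν X) (a : Fin K) (n : ℕ) :
    IndepFun (X a n) (fun ω => Function.update (fun i : Fin K × ℕ => X i.1 i.2 ω) (a, n) 0) P := by
  have h := indep_iSup_of_disjoint (μ := P)
    (m := fun i : Fin K × ℕ => MeasurableSpace.comap (X i.1 i.2) inferInstance)
    (fun i => (hX.measurable i.1 i.2).comap_le) hX.indep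
    (S := {(a, n)}) (T := {(a, n)}ᶜ) disjoint_compl_right
  refine indep_of_indep_of_le_left (indep_of_indep_of_le_right h ?_) ?_
  · rw [← measurable_iff_comap_le]
    refine @measurable_pi_lambda _ _ _ (_) _ _ fun i => ?_
    by_cases hi : i = (a, n)
    · subst hi
      simp
    · simp only [ne_eq, hi, not_false_eq_true, Function.update_of_ne]
      rw [measurable_iff_comap_le]
      exact le_iSup₂_of_le i hi le_rfl
  · exact le_iSup₂_of_le (a, n) rfl le_rfl

theorem IsAdmissible.exists_history {S : Type*} [MeasurableSpace S] {X : Fin K → ℕ → Ω → Θ}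
    {ξ : Ω → S} {A : ℕ → Ω → Fin K} (hA : IsAdmissible P X ξ A) :
    ∃ f : ∀ t : ℕ, S × (Fin t → Fin K × Θ) → Fin K, (∀ t, Measurable (f t)) ∧
      ∀ t ω, A (t + 1) ω = f t (ξ ω, fun s : Fin t => (A (s + 1) ω, reward X A (s + 1) ω)) := by
  choose f h1 h2 using hA.nonanticipating
  exact ⟨f, h1, h2⟩

theorem IsRewardTable.measurable_table {ν : Fin K → ProbabilityMeasure Θ}
    {X : Fin K → ℕ → Ω → Θ} (hX : IsRewardTable P ν X) :
    Measurable fun ω (i : Fin K × ℕ) => X i.1 i.2 ω :=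
  measurable_pi_lambda _ fun i => hX.measurable i.1 i.2

theorem measurable_pulls {S : Type*} [MeasurableSpace S] {ν : Fin K → ProbabilityMeasure Θ}
    {X : Fin K → ℕ → Ω → Θ} (hX : IsRewardTable P ν X) {ξ : Ω → S} {A : ℕ → Ω → Fin K}
    (hA : IsAdmissible P X ξ A) (a : Fin K) (t : ℕ) : Measurable (pulls A a t) := by
  obtain ⟨f, hf, hfA⟩ := hA.exists_history
  have := (measurable_histCount a).comp ((measurable_history hf t).comp
    (hA.measurable_seed.prodMk hX.measurable_table))
  convert this using 1
  ext ω
  exact (histCount_history hfA t ω a).symm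

/-- As long as `a` has been played fewer than `n` times, entry `(a, n)` has not been read.
Overwriting it does not change the event, which therefore depends only on the seed and the other
entries. -/
theorem indepFun_pulls_lt [IsProbabilityMeasure P] {S : Type*} [MeasurableSpace S] {ν : Fin K → ProbabilityMeasure Θ}
    {X : Fin K → ℕ → Ω → Θ} (hX : IsRewardTable P ν X) {ξ : Ω → S} {A : ℕ → Ω → Fin K}
    (hA : IsAdmissible P X ξ A) (a : Fin K) (n T : ℕ) :
    IndepFun (fun ω => (X a n ω : ℝ)) (fun ω => if pulls A a T ω < n then (0 : ℝ) else 1) P := by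
  obtain ⟨f, hf, hfA⟩ := hA.exists_history
  have hup : Measurable fun x : Fin K × ℕ → Θ => Function.update x (a, n) 0 :=
    measurable_pi_lambda _ fun i => by
      by_cases hi : i = (a, n)
      · subst hi; simp
      · simp only [ne_eq, hi, not_false_eq_true, Function.update_of_ne]
        exact measurable_pi_apply i
  have h1 := indepFun_prodMk_of_indepFun (hX.measurable a n) hA.measurable_seed
    (hup.comp hX.measurable_table)
    (hA.indep_seed.comp measurable_id ((measurable_pi_apply (a, n)).prodMk hup))
    (hX.indepFun_update a n)
  have hg : Measurable fun p : S × (Fin K × ℕ → Θ) =>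
      if histCount (history f p.1 p.2 T) a < n then (0 : ℝ) else 1 :=
    Measurable.ite (((measurable_histCount a).comp (measurable_history hf T))
      (measurableSet_Iio (a := n))) measurable_const measurable_const
  have h2 := h1.comp measurable_subtype_coe hg
  refine h2.congr EventuallyEq.rfl (Eventually.of_forall fun ω => ?_)
  have hiff : pulls A a T ω < n ↔ histCount (history f (ξ ω)
      (Function.update (fun i : Fin K × ℕ => X i.1 i.2 ω) (a, n) 0) T) a < n := by
    rw [← histCount_history hfA]
    have hx : ∀ i, i ≠ (a, n) → (fun i : Fin K × ℕ => X i.1 i.2 ω) i =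
        Function.update (fun i : Fin K × ℕ => X i.1 i.2 ω) (a, n) 0 i := fun i hi => by
      simp [hi]
    refine ⟨fun h => ?_, fun h => ?_⟩
    · rwa [← history_congr f (ξ ω) hx T h]
    · rwa [history_congr f (ξ ω) (fun i hi => (hx i hi).symm) T h] at h
  simp only [Function.comp_apply, hiff]

theorem IsRewardTable.integral_eq {ν : Fin K → ProbabilityMeasure Θ}
    {X : Fin K → ℕ → Ω → Θ} (hX : IsRewardTable P ν X) (a : Fin K) (n : ℕ) :
    ∫ ω, (X a n ω : ℝ) ∂P = armMean (ν a) := by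
  have : ∫ x, (x : ℝ) ∂(P.map (X a n)) = ∫ ω, (X a n ω : ℝ) ∂P :=
    integral_map (hX.measurable a n).aemeasurable measurable_subtype_coe.aestronglyMeasurable
  rw [← this, hX.law]
  rfl

/-- Wald's identity: entry `i + 1` of arm `a` is collected exactly when `N_a(T) > i`, an event
independent of its value, so each expectation factors. -/
theorem integral_sum_reward [IsProbabilityMeasure P] {S : Type*} [MeasurableSpace S] {ν : Fin K → ProbabilityMeasure Θ}
    {X : Fin K → ℕ → Ω → Θ} (hX : IsRewardTable P ν X) {ξ : Ω → S} {A : ℕ → Ω → Fin K}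
    (hA : IsAdmissible P X ξ A) (T : ℕ) :
    Integrable (fun ω => ∑ t ∈ Finset.Icc 1 T, (reward X A t ω : ℝ)) P ∧
    ∫ ω, ∑ t ∈ Finset.Icc 1 T, (reward X A t ω : ℝ) ∂P =
      ∑ a, (armMean (ν a) : ℝ) * ∫ ω, (pulls A a T ω : ℝ) ∂P := by
  have hmul : ∀ a i ω, (if i < pulls A a T ω then (X a (i + 1) ω : ℝ) else 0) =
      (X a (i + 1) ω : ℝ) * if pulls A a T ω < i + 1 then (0 : ℝ) else 1 := by
    intro a i ω
    by_cases h : i < pulls A a T ω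
    · simp [h, show ¬ pulls A a T ω < i + 1 by omega]
    · simp [h, show pulls A a T ω < i + 1 by omega]
  have hmX : ∀ a n, Measurable fun ω => (X a n ω : ℝ) := fun a n =>
    measurable_subtype_coe.comp (hX.measurable a n)
  have hmI : ∀ a i, Measurable fun ω => if pulls A a T ω < i + 1 then (0 : ℝ) else 1 := fun a i =>
    Measurable.ite (measurable_pulls hX hA a T (measurableSet_Iio (a := i + 1)))
      measurable_const measurable_const
  have hiI : ∀ a i, Integrable (fun ω => if pulls A a T ω < i + 1 then (0 : ℝ) else 1) P :=
    fun a i => Integrable.of_mem_Icc 0 1 (hmI a i).aemeasurable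
      (Eventually.of_forall fun ω => by split_ifs <;> simp)
  have hint : ∀ a i, Integrable
      (fun ω => if i < pulls A a T ω then (X a (i + 1) ω : ℝ) else 0) P := fun a i => by
    refine Integrable.of_mem_Icc 0 1 ?_ (Eventually.of_forall fun ω => ?_)
    · simp only [hmul]
      exact ((hmX a (i + 1)).mul (hmI a i)).aemeasurable
    · split_ifs
      · exact (X a (i + 1) ω).2
      · simp
  simp only [sum_reward_eq]
  refine ⟨integrable_finsetSum _ fun a _ => integrable_finsetSum _ fun i _ => hint a i, ?_⟩
  rw [integral_finsetSum _ fun a _ => integrable_finsetSum _ fun i _ => hint a i]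
  refine Finset.sum_congr rfl fun a _ => ?_
  rw [integral_finsetSum _ fun i _ => hint a i]
  have hp : ∀ ω, (pulls A a T ω : ℝ) =
      ∑ i ∈ Finset.range T, if pulls A a T ω < i + 1 then (0 : ℝ) else 1 := by
    intro ω
    have : (Finset.range T).filter (fun i => ¬ pulls A a T ω < i + 1) =
        Finset.range (pulls A a T ω) := by
      have := pulls_le A a T ω
      ext i
      simp only [Finset.mem_range, Finset.mem_filter]
      omega
    have hc := congrArg (fun s : Finset ℕ => (s.card : ℝ)) this
    simp only [Finset.card_range, Finset.card_filter] at hc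
    rw [← hc]
    push_cast
    simp only [ite_not]
  simp only [hp]
  rw [integral_finsetSum _ fun i _ => hiI a i, Finset.mul_sum]
  refine Finset.sum_congr rfl fun i _ => ?_
  simp only [hmul]
  rw [(indepFun_pulls_lt hX hA a (i + 1) T).integral_fun_mul_eq_mul_integral
    (hmX a (i + 1)).aestronglyMeasurable (hmI a i).aestronglyMeasurable, hX.integral_eq]

theorem integrable_pulls [IsProbabilityMeasure P] {S : Type*} [MeasurableSpace S]
    {ν : Fin K → ProbabilityMeasure Θ} {X : Fin K → ℕ → Ω → Θ} (hX : IsRewardTable P ν X)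
    {ξ : Ω → S} {A : ℕ → Ω → Fin K} (hA : IsAdmissible P X ξ A) (a : Fin K) (T : ℕ) :
    Integrable (fun ω => (pulls A a T ω : ℝ)) P :=
  Integrable.of_mem_Icc 0 T (measurable_from_top.comp (measurable_pulls hX hA a T)).aemeasurable
    (Eventually.of_forall fun ω => ⟨Nat.cast_nonneg _, Nat.cast_le.2 (pulls_le A a T ω)⟩)

theorem regret_eq_sum [IsProbabilityMeasure P] {S : Type*} [MeasurableSpace S] {ν : Fin K → ProbabilityMeasure Θ}
    {X : Fin K → ℕ → Ω → Θ} (hX : IsRewardTable P ν X) {ξ : Ω → S} {A : ℕ → Ω → Fin K}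
    (hA : IsAdmissible P X ξ A) (T : ℕ) :
    regret P ν X A T =
      ∑ a, ((bestMean ν : ℝ) - armMean (ν a)) * ∫ ω, (pulls A a T ω : ℝ) ∂P := by
  obtain ⟨h1, h2⟩ := integral_sum_reward hX hA T
  have h3 : ∑ a, ∫ ω, (pulls A a T ω : ℝ) ∂P = T := by
    rw [← integral_finsetSum _ fun a _ => integrable_pulls hX hA a T]
    have : ∀ ω, ∑ a, (pulls A a T ω : ℝ) = T := fun ω => by exact_mod_cast sum_pulls A T ω
    simp [this]
  unfold regret
  rw [integral_sub (integrable_const _) h1, h2]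
  simp only [integral_const, probReal_univ, one_smul, sub_mul, Finset.sum_sub_distrib,
    ← Finset.mul_sum, h3]
  ring

end Decomposition

/-! ### The indices -/

section Index

variable {D : Set (Θ → Θ → EReal)} {d : Θ → Θ → EReal}

theorem bddAbove_coe_image (s : Set Θ) : BddAbove ((fun q : Θ => (q : ℝ)) '' s) :=
  ⟨1, by rintro _ ⟨q, -, rfl⟩; exact q.2.2⟩

theorem ucbIndex_nonneg (d : Θ → Θ → EReal) (c : ℝ) (p : Θ) (N t : ℕ) :
    0 ≤ ucbIndex d c p N t :=
  Real.sSup_nonneg (by rintro _ ⟨q, -, rfl⟩; exact q.2.1)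

/-- The supremum over the empty set is `⊥`, which is not nonnegative. -/
theorem IsFeasible.nonempty (h : IsFeasible D) : D.Nonempty := by
  by_contra! hD
  subst hD
  have := h.strong.nonneg 0 0
  simp [maxOf] at this

/-- An index below `q` forces a large divergence of the empirical mean from `q`. -/
theorem of_boostIndex_lt (hcand : ∀ d ∈ D, IsCandidateSemiDistance d) (hfeas : IsFeasible D)
    {c : ℝ} {p q : Θ} {N t : ℕ} (hb : 0 ≤ Real.log t + c * Real.log (Real.log t))
    (h : boostIndex D c p N t < q) :
    p < q ∧ ((Real.log t + c * Real.log (Real.log t) : ℝ) : EReal) < (N : EReal) * dkl p q := by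
  obtain ⟨_, ⟨d, hd, rfl⟩, hlt⟩ := exists_lt_of_csInf_lt (hfeas.nonempty.image _) h
  have hmem : ∀ u : Θ, (N : EReal) * d p u ≤
      ((Real.log t + c * Real.log (Real.log t) : ℝ) : EReal) → u < q := fun u hu =>
    Subtype.coe_lt_coe.1 ((le_csSup (bddAbove_coe_image _) ⟨u, hu, rfl⟩).trans_lt hlt)
  -- Since `d p p ≤ 0`, the point `p` is itself admissible in the index; the point `q` is not.
  refine ⟨hmem p ?_, ?_⟩
  · exact (mul_nonpos_of_nonneg_of_nonpos (by positivity) ((hcand d hd).self_nonpos p)).trans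
      (by exact_mod_cast hb)
  · have h1 := not_le.1 fun h' => lt_irrefl q (hmem q h')
    have h2 : d p q ≤ dkl p q := (le_iSup₂ (f := fun d (_ : d ∈ D) => d p q) d hd).trans
      (hfeas.dominated p q)
    exact h1.trans_le (by gcongr)

/-- An index of at least `q` forces a small number of observations, unless the empirical mean is
close to `q`. -/
theorem mul_lt_of_le_boostIndex (hcand : ∀ d ∈ D, IsCandidateSemiDistance d)
    (hmax : ∀ d ∈ D, IndexExists d) {c : ℝ} {p q : Θ} {N t : ℕ} (hN : 0 < N)
    (hb : 0 < Real.log t + c * Real.log (Real.log t)) (hpq : p ≤ q)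
    (h : (q : ℝ) ≤ boostIndex D c p N t) {r : ℝ} (hr : (r : EReal) < maxOf D p q) :
    N * r < Real.log t + c * Real.log (Real.log t) := by
  set β := Real.log t + c * Real.log (Real.log t) with hβ
  have hN' : (0 : ℝ) < N := by exact_mod_cast hN
  obtain ⟨d, hd, hrd⟩ : ∃ d ∈ D, (r : EReal) < d p q := by
    simpa [maxOf, lt_iSup_iff] using hr
  have h1 : (q : ℝ) ≤ ucbIndex d c p N t :=
    h.trans (csInf_le ⟨0, by rintro _ ⟨d, -, rfl⟩; exact ucbIndex_nonneg d c p N t⟩ ⟨d, hd, rfl⟩)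
  have hset : ∀ x : EReal, (N : EReal) * x ≤ (β : EReal) ↔ x ≤ ((β / N : ℝ) : EReal) := by
    intro x
    rw [EReal.coe_div, EReal.coe_natCast, EReal.le_div_iff_mul_le (by exact_mod_cast hN)
      (EReal.natCast_ne_top N), mul_comm]
  -- Attainment matters: an unattained supremum could equal `q` although `q` violates the
  -- constraint.
  obtain ⟨u, hu, hub⟩ := hmax d hd p (β / N) (by positivity)
  have hqu : q ≤ u := by
    refine Subtype.coe_le_coe.1 (h1.trans (csSup_le ⟨u, u, (hset _).2 hu, rfl⟩ ?_))
    rintro _ ⟨v, hv, rfl⟩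
    exact hub ((hset _).1 hv)
  have h2 := hrd.trans_le (((hcand d hd).mono_right p q u hpq hqu).trans hu)
  rw [EReal.coe_lt_coe_iff, lt_div_iff₀ hN'] at h2
  linarith

/-- The exploration bonus `log t + 3 log log t`. -/
noncomputable def bonus (t : ℕ) : ℝ := Real.log t + 3 * Real.log (Real.log t)

theorem one_lt_log {t : ℕ} (ht : 3 ≤ t) : 1 < Real.log t := by
  have h3 : (3 : ℝ) ≤ t := by exact_mod_cast ht
  rw [Real.lt_log_iff_exp_lt (by linarith)]
  linarith [Real.exp_one_lt_d9]

theorem bonus_pos {t : ℕ} (ht : 3 ≤ t) : 0 < bonus t := by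
  have := one_lt_log ht
  have := Real.log_pos this
  unfold bonus
  linarith

theorem bonus_mono {s t : ℕ} (hs : 3 ≤ s) (hst : s ≤ t) : bonus s ≤ bonus t := by
  have h1 := one_lt_log hs
  have hs' : (3 : ℝ) ≤ s := by exact_mod_cast hs
  have h2 : Real.log s ≤ Real.log t :=
    Real.log_le_log (by linarith) (by exact_mod_cast hst)
  have h3 := Real.log_le_log (by linarith) h2
  unfold bonus
  linarith

end Index

/-! ### The exceptional events -/

section Events

variable {K : ℕ} {Ω : Type*}

/-- Some empirical mean of arm `b` from at most `t` observations lies below `q` and is far from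
`q` with respect to `dkl`. -/
def underestimated (X : Fin K → ℕ → Ω → Θ) (b : Fin K) (q : Θ) (t : ℕ) : Set Ω :=
  {ω | ∃ n : ℕ, 1 ≤ n ∧ n ≤ t ∧ ∃ x : Θ,
    (x : ℝ) = (∑ i ∈ Finset.range n, (X b (i + 1) ω : ℝ)) / n ∧ x < q ∧
      (bonus t : EReal) < (n : EReal) * dkl x q}

/-- The empirical mean of the first `n` observations from arm `a` exceeds `p`. -/
def overestimated (X : Fin K → ℕ → Ω → Θ) (a : Fin K) (p : Θ) (n : ℕ) : Set Ω :=
  {ω | (p : ℝ) < (∑ i ∈ Finset.range n, (X a (i + 1) ω : ℝ)) / n}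

variable [MeasurableSpace Ω] {P : Measure Ω}
  {ν : Fin K → ProbabilityMeasure Θ} {X : Fin K → ℕ → Ω → Θ}

theorem IsRewardTable.iIndepFun_arm (hX : IsRewardTable P ν X) (a : Fin K) :
    iIndepFun (fun i ω => (X a (i + 1) ω : ℝ)) P :=
  (hX.indep.precomp (g := fun i : ℕ => (a, i + 1)) fun i j h => by simpa using h).comp
    (fun _ => Subtype.val) fun _ => measurable_subtype_coe

theorem IsRewardTable.measurable_arm (hX : IsRewardTable P ν X) (a : Fin K) (n : ℕ) :
    Measurable fun ω => (X a n ω : ℝ) :=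
  measurable_subtype_coe.comp (hX.measurable a n)

/-- Hoeffding's inequality: a variable in `[0, 1]` is subgaussian with variance proxy `1/4`. For `n
= 0` the bound is 1. -/
theorem measureReal_overestimated_le [IsProbabilityMeasure P] (hX : IsRewardTable P ν X) (a : Fin K) {p : Θ}
    (hp : armMean (ν a) < p) (n : ℕ) :
    P.real (overestimated X a p n) ≤ Real.exp (-2 * ((p : ℝ) - armMean (ν a)) ^ 2) ^ n := by
  set ε : ℝ := (p : ℝ) - armMean (ν a) with hε
  have hε0 : 0 < ε := sub_pos.2 hp
  rcases Nat.eq_zero_or_pos n with rfl | hn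
  · simp
  have hn' : (0 : ℝ) < n := by exact_mod_cast hn
  have hsub : ∀ i, HasSubgaussianMGF (fun ω => (X a (i + 1) ω : ℝ) - (armMean (ν a) : ℝ))
      ((‖(1 : ℝ) - 0‖₊ / 2) ^ 2) P := fun i => by
    have := hasSubgaussianMGF_of_mem_Icc (μ := P) (a := 0) (b := 1)
      (X := fun ω => (X a (i + 1) ω : ℝ)) (hX.measurable_arm a (i + 1)).aemeasurable
      (Eventually.of_forall fun ω => (X a (i + 1) ω).2)
    rwa [hX.integral_eq] at this
  have h := HasSubgaussianMGF.measure_sum_range_ge_le_of_iIndepFun (n := n)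
    ((hX.iIndepFun_arm a).comp (fun _ x => x - (armMean (ν a) : ℝ)) fun _ => by fun_prop)
    (fun i _ => hsub i) (ε := n * ε) (by positivity)
  refine (measureReal_mono ?_ (measure_ne_top _ _)).trans (h.trans (le_of_eq ?_))
  · intro ω hω
    have h1 := (lt_div_iff₀ hn').1 hω
    show n * ε ≤ ∑ i ∈ Finset.range n, ((X a (i + 1) ω : ℝ) - (armMean (ν a) : ℝ))
    rw [Finset.sum_sub_distrib]
    simp only [Finset.sum_const, Finset.card_range, nsmul_eq_mul]
    rw [hε]
    nlinarith
  · rw [← Real.exp_nat_mul]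
    congr 1
    simp
    field_simp

/-- Peeling with ratio `1 + 1 / log t` gives `O(log² t)` slices, each of probability `O(1 / (t log³
t))`. The coefficient 3 of the bonus supplies the cube. -/
theorem measureReal_underestimated_le [IsProbabilityMeasure P] (hX : IsRewardTable P ν X) (b : Fin K) {t : ℕ}
    (ht : 3 ≤ t) :
    P.real (underestimated X b (armMean (ν b)) t) ≤
      3 * Real.exp 4 / (t * Real.log t) := by
  have hl := one_lt_log ht
  have ht0 : (0 : ℝ) < t := by positivity
  set q := armMean (ν b) with hq
  have hR : 0 ≤ 3 * Real.exp 4 / (t * Real.log t) := by positivity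
  rcases (q.2.1).eq_or_lt with hq0 | hq0
  · refine le_trans (le_of_eq ?_) hR
    convert measureReal_empty (μ := P)
    rw [Set.eq_empty_iff_forall_notMem]
    rintro ω ⟨n, -, -, x, -, hxq, -⟩
    have := x.2.1
    have : (x : ℝ) < q := hxq
    linarith
  -- If `q = 1`, all rewards of `b` are almost surely 1 and no empirical mean lies below `q`.
  rcases (q.2.2).eq_or_lt with hq1 | hq1
  · refine le_trans (le_of_eq ?_) hR
    have hae : ∀ i, ∀ᵐ ω ∂P, (X b (i + 1) ω : ℝ) = 1 := fun i => by
      have hint : Integrable (fun ω => (X b (i + 1) ω : ℝ)) P := Integrable.of_mem_Icc 0 1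
        (hX.measurable_arm b (i + 1)).aemeasurable
        (Eventually.of_forall fun ω => (X b (i + 1) ω).2)
      have h0 : ∫ ω, (1 - (X b (i + 1) ω : ℝ)) ∂P = 0 := by
        rw [integral_sub (integrable_const _) hint, hX.integral_eq, ← hq, hq1]
        simp
      have := (integral_eq_zero_iff_of_nonneg (fun ω => sub_nonneg.2 (X b (i + 1) ω).2.2)
        ((integrable_const _).sub hint)).1 h0
      filter_upwards [this] with ω hω
      have : 1 - (X b (i + 1) ω : ℝ) = 0 := hω
      linarith
    have hnull : ∀ᵐ ω ∂P, ω ∉ underestimated X b q t := by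
      filter_upwards [ae_all_iff.2 hae] with ω hω
      rintro ⟨n, hn, -, x, hx, hxq, -⟩
      have hn' : (n : ℝ) ≠ 0 := by positivity
      simp only [hω, Finset.sum_const, Finset.card_range, nsmul_eq_mul, mul_one,
        div_self hn'] at hx
      have : (x : ℝ) < q := hxq
      linarith
    rw [measureReal_eq_zero_iff]
    exact measure_eq_zero_iff_ae_notMem.2 hnull
  set ℓ := Real.log t with hℓ
  have hγ : 1 < 1 + 1 / ℓ := by
    have : 0 < 1 / ℓ := by positivity
    linarith
  have hdev := measureReal_exists_lower_deviation_le (P := P)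
    (fun i => hX.measurable_arm b (i + 1)) (hX.iIndepFun_arm b)
    (fun i ω => (X b (i + 1) ω).2) (fun i => hX.integral_eq b (i + 1)) hq0 hq1 (bonus_pos ht) hγ
    (show 1 ≤ t by omega)
  refine (measureReal_mono ?_ (measure_ne_top _ _)).trans (hdev.trans ?_)
  · rintro ω ⟨n, hn, hnt, x, hx, hxq, hkl⟩
    have hn' : (0 : ℝ) < n := by exact_mod_cast hn
    refine ⟨n, hn, hnt, ?_, ?_⟩
    · have : (x : ℝ) < q := hxq
      rwa [hx, div_lt_iff₀' hn'] at this
    · rw [dkl_eq_coe x q hq0 hq1, ← EReal.coe_natCast, ← EReal.coe_mul,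
        EReal.coe_lt_coe_iff, hx] at hkl
      exact hkl
  · have hlogγ : 1 / (ℓ + 1) ≤ Real.log (1 + 1 / ℓ) := by
      have := Real.one_sub_inv_le_log_of_pos (show 0 < 1 + 1 / ℓ by linarith)
      refine le_trans (le_of_eq ?_) this
      field_simp
      ring
    have h1 : ℓ / Real.log (1 + 1 / ℓ) ≤ ℓ * (ℓ + 1) := by
      rw [div_le_iff₀ (Real.log_pos hγ)]
      calc ℓ = ℓ * (ℓ + 1) * (1 / (ℓ + 1)) := by field_simp
        _ ≤ _ := by gcongr
    have hll : Real.log ℓ ≤ ℓ - 1 := Real.log_le_sub_one_of_pos (by linarith)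
    -- Dividing by the ratio loses `bonus t / (ℓ + 1)`, which is at most 4 because `log ℓ ≤ ℓ - 1`.
    have h2 : bonus t - 4 ≤ bonus t / (1 + 1 / ℓ) := by
      have e : bonus t / (1 + 1 / ℓ) = bonus t * ℓ / (ℓ + 1) := by field_simp
      rw [e, le_div_iff₀ (by linarith)]
      have : bonus t = ℓ + 3 * Real.log ℓ := rfl
      nlinarith
    have h3 : Real.exp (-(bonus t / (1 + 1 / ℓ))) ≤ Real.exp 4 / (t * ℓ ^ 3) := by
      have e : Real.exp 4 / (t * ℓ ^ 3) = Real.exp (4 - bonus t) := by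
        have e1 : bonus t = ℓ + 3 * Real.log ℓ := rfl
        rw [Real.exp_sub, e1, Real.exp_add, hℓ, Real.exp_log ht0, ← hℓ]
        congr 2
        rw [mul_comm, Real.exp_mul, Real.exp_log (by linarith)]
        norm_cast
      rw [e, Real.exp_le_exp]
      linarith
    calc _ ≤ (ℓ * (ℓ + 1) + 1) * (Real.exp 4 / (t * ℓ ^ 3)) := by gcongr
      _ ≤ (3 * ℓ ^ 2) * (Real.exp 4 / (t * ℓ ^ 3)) := by gcongr; nlinarith
      _ = _ := by field_simp

end Events

/-! ### Counting the plays of a suboptimal arm -/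

section Counting

variable {K : ℕ} {Ω : Type*} {D : Set (Θ → Θ → EReal)} {X : Fin K → ℕ → Ω → Θ}
  {A : ℕ → Ω → Fin K}

theorem FollowsUCBoost.pulls_pos (hUCB : FollowsUCBoost D 3 X A) {t : ℕ} (ht : K ≤ t)
    (a : Fin K) (ω : Ω) : 0 < pulls A a t ω := by
  refine lt_of_lt_of_le ?_ (pulls_mono A a ω (show (a : ℕ) + 1 ≤ t from le_trans a.2 ht))
  have h := hUCB.init (a + 1) ω (by omega) a.2
  have : A (a + 1) ω = a := Fin.ext (by omega)
  simp [pulls_succ, this]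

theorem empMean_eq (a : Fin K) (t : ℕ) (ω : Ω) : (empMean X A a t ω : ℝ) =
    (∑ i ∈ Finset.range (pulls A a t ω), (X a (i + 1) ω : ℝ)) / (pulls A a t ω : ℝ) := by
  rw [← armSum_eq_sum]
  rfl

/-- When arm `a` is played, either the mean of arm `b` was underestimated, or that of arm `a` was
overestimated, or arm `a` has been observed few times. -/
theorem FollowsUCBoost.play_cases (hcand : ∀ d ∈ D, IsCandidateSemiDistance d)
    (hfeas : IsFeasible D) (hmax : ∀ d ∈ D, IndexExists d) (hUCB : FollowsUCBoost D 3 X A)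
    {p q : Θ} (hpq : p ≤ q) {c : ℝ} (hc : (c : EReal) < maxOf D p q) {a : Fin K} (b : Fin K)
    {t : ℕ} (ht : K + 2 ≤ t) {ω : Ω} (hA : A (t + 1) ω = a) :
    ω ∈ underestimated X b q (t + 1) ∨ ω ∈ overestimated X a p (pulls A a t ω) ∨
      pulls A a t ω * c ≤ bonus (t + 1) := by
  have hK : 0 < K := a.pos
  by_contra! h
  obtain ⟨h1, h2, h3⟩ := h
  have hb := bonus_pos (show 3 ≤ t + 1 by omega)
  have hle : (q : ℝ) ≤ boostIndex D 3 (empMean X A b t ω) (pulls A b t ω) (t + 1) := by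
    by_contra! hlt
    obtain ⟨h4, h5⟩ := of_boostIndex_lt hcand hfeas hb.le hlt
    exact h1 ⟨pulls A b t ω, hUCB.pulls_pos (by omega) b ω, (pulls_le A b t ω).trans (by omega),
      _, empMean_eq b t ω, h4, h5⟩
  have harg := hUCB.argmax (t + 1) ω (by omega) b
  rw [hA, Nat.add_sub_cancel] at harg
  have hp : empMean X A a t ω ≤ p := by
    rw [← Subtype.coe_le_coe, empMean_eq]
    exact not_lt.1 h2
  have := mul_lt_of_le_boostIndex hcand hmax (hUCB.pulls_pos (by omega) a ω) hb (hp.trans hpq)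
    (hle.trans harg) (hc.trans_le (hfeas.strong.anti_left _ _ _ hp hpq))
  exact absurd this (not_lt.2 h3.le)

theorem indicator_one_nonneg (E : Set Ω) (ω : Ω) : 0 ≤ E.indicator (1 : Ω → ℝ) ω :=
  Set.indicator_nonneg (fun _ _ => zero_le_one) ω

/-- A pathwise charging argument: each play of `a` is charged to its round (an early one, or one
where `b` is underestimated) or to the number `n` of earlier plays of `a`. Every round and every `n`
is charged at most once. -/
theorem FollowsUCBoost.pulls_le_sum (hcand : ∀ d ∈ D, IsCandidateSemiDistance d)
    (hfeas : IsFeasible D) (hmax : ∀ d ∈ D, IndexExists d) (hUCB : FollowsUCBoost D 3 X A)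
    {p q : Θ} (hpq : p ≤ q) {c : ℝ} (hc : (c : EReal) < maxOf D p q) (hc0 : 0 < c)
    (a b : Fin K) {T : ℕ} (hT : 3 ≤ T) (ω : Ω) :
    (pulls A a T ω : ℝ) ≤ (K + 2) + (bonus T / c + 1) +
      ∑ t ∈ Finset.Icc 1 T, (underestimated X b q t).indicator (1 : Ω → ℝ) ω +
      ∑ n ∈ Finset.range T, (overestimated X a p n).indicator (1 : Ω → ℝ) ω := by
  -- The bonus is frozen at the horizon `T`, so that the charges to `n` do not depend on the round.
  have key : ∀ t ≤ T, (pulls A a t ω : ℝ) ≤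
      ∑ s ∈ Finset.Icc 1 t, ((if s ≤ K + 2 then (1 : ℝ) else 0) +
        (underestimated X b q s).indicator (1 : Ω → ℝ) ω) +
      ∑ n ∈ Finset.range (pulls A a t ω), ((if (n : ℝ) * c ≤ bonus T then (1 : ℝ) else 0) +
        (overestimated X a p n).indicator (1 : Ω → ℝ) ω) := by
    intro t ht
    induction t with
    | zero => simp [pulls_zero]
    | succ t ih =>
      specialize ih (by omega)
      rw [Finset.sum_Icc_succ_top (by omega)]
      have hu := indicator_one_nonneg (underestimated X b q (t + 1)) ω
      have ho := indicator_one_nonneg (overestimated X a p (pulls A a t ω)) ω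
      have hi1 : (0 : ℝ) ≤ if t + 1 ≤ K + 2 then 1 else 0 := by split_ifs <;> simp
      have hi2 : (0 : ℝ) ≤ if (pulls A a t ω : ℝ) * c ≤ bonus T then 1 else 0 := by
        split_ifs <;> simp
      by_cases hA : A (t + 1) ω = a
      · rw [pulls_succ, if_pos hA, Finset.sum_range_succ]
        rw [Nat.cast_succ]
        suffices (1 : ℝ) ≤ (if t + 1 ≤ K + 2 then 1 else 0) +
            (underestimated X b q (t + 1)).indicator (1 : Ω → ℝ) ω +
            ((if (pulls A a t ω : ℝ) * c ≤ bonus T then 1 else 0) +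
              (overestimated X a p (pulls A a t ω)).indicator (1 : Ω → ℝ) ω) by linarith
        by_cases htK : t + 1 ≤ K + 2
        · rw [if_pos htK] at hi1 ⊢
          linarith
        · rcases hUCB.play_cases hcand hfeas hmax hpq hc b (by omega) hA with h | h | h
          · rw [Set.indicator_of_mem h] at hu ⊢
            simp only [Pi.one_apply]
            linarith
          · rw [Set.indicator_of_mem h] at ho ⊢
            simp only [Pi.one_apply]
            linarith
          · have h' := h.trans (bonus_mono (show 3 ≤ t + 1 by omega) ht)
            rw [if_pos h'] at hi2 ⊢
            linarith
      · rw [pulls_succ, if_neg hA, Nat.add_zero]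
        linarith
  refine (key T le_rfl).trans ?_
  rw [Finset.sum_add_distrib, Finset.sum_add_distrib]
  have h1 : ∑ s ∈ Finset.Icc 1 T, (if s ≤ K + 2 then (1 : ℝ) else 0) ≤ K + 2 := by
    rw [← Finset.sum_filter, Finset.sum_const, nsmul_eq_mul, mul_one]
    have : ((Finset.Icc 1 T).filter fun s => s ≤ K + 2) ⊆ Finset.Icc 1 (K + 2) := fun s hs => by
      simp only [Finset.mem_filter, Finset.mem_Icc] at hs ⊢
      omega
    have := Finset.card_le_card this
    rw [Nat.card_Icc, Nat.add_sub_cancel] at this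
    exact_mod_cast this
  have h2 : ∑ n ∈ Finset.range (pulls A a T ω), (if (n : ℝ) * c ≤ bonus T then (1 : ℝ) else 0) ≤
      bonus T / c + 1 := by
    rw [← Finset.sum_filter, Finset.sum_const, nsmul_eq_mul, mul_one]
    have hsub : ((Finset.range (pulls A a T ω)).filter fun n : ℕ => (n : ℝ) * c ≤ bonus T) ⊆
        Finset.range (⌊bonus T / c⌋₊ + 1) := fun n hn => by
      simp only [Finset.mem_filter, Finset.mem_range] at hn ⊢
      exact Nat.lt_succ_of_le (Nat.le_floor ((le_div_iff₀ hc0).2 hn.2))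
    have hcard := Finset.card_le_card hsub
    rw [Finset.card_range] at hcard
    calc _ ≤ ((⌊bonus T / c⌋₊ + 1 : ℕ) : ℝ) := by exact_mod_cast hcard
      _ ≤ _ := by
        push_cast
        gcongr
        exact Nat.floor_le (div_nonneg (bonus_pos hT).le hc0.le)
  have h3 : ∑ n ∈ Finset.range (pulls A a T ω), (overestimated X a p n).indicator (1 : Ω → ℝ) ω ≤
      ∑ n ∈ Finset.range T, (overestimated X a p n).indicator (1 : Ω → ℝ) ω :=
    Finset.sum_le_sum_of_subset_of_nonneg (Finset.range_mono (pulls_le A a T ω))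
      fun n _ _ => indicator_one_nonneg _ ω
  linarith

end Counting

/-! ### The regret bound -/

section Regret

variable {K : ℕ} {Ω : Type*} [MeasurableSpace Ω] {P : Measure Ω}

/-- Replacing the events by measurable hulls of equal probability avoids any measurability
assumption on them. -/
theorem integral_le_add_sum_measureReal [IsProbabilityMeasure P] {f : Ω → ℝ} {C : ℝ}
    (hf : Integrable f P) {ι κ : Type*} (s : Finset ι) (u : Finset κ) (E : ι → Set Ω)
    (F : κ → Set Ω)
    (h : ∀ ω, f ω ≤ C + ∑ i ∈ s, (E i).indicator (1 : Ω → ℝ) ω +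
      ∑ j ∈ u, (F j).indicator (1 : Ω → ℝ) ω) :
    ∫ ω, f ω ∂P ≤ C + ∑ i ∈ s, P.real (E i) + ∑ j ∈ u, P.real (F j) := by
  have hint : ∀ G : Set Ω, Integrable ((toMeasurable P G).indicator (1 : Ω → ℝ)) P := fun G =>
    (integrable_const (1 : ℝ)).indicator (measurableSet_toMeasurable P G)
  have hval : ∀ G : Set Ω, ∫ ω, (toMeasurable P G).indicator (1 : Ω → ℝ) ω ∂P = P.real G :=
    fun G => by
      rw [integral_indicator_one (measurableSet_toMeasurable P G), Measure.real,
        measure_toMeasurable, Measure.real]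
  have hle : ∀ (G : Set Ω) (ω : Ω), G.indicator (1 : Ω → ℝ) ω ≤
      (toMeasurable P G).indicator (1 : Ω → ℝ) ω := fun G ω =>
    Set.indicator_le_indicator_of_subset (subset_toMeasurable P G) (fun _ => zero_le_one) ω
  have hE := integrable_finsetSum s fun i _ => hint (E i)
  have hF := integrable_finsetSum u fun j _ => hint (F j)
  calc ∫ ω, f ω ∂P ≤ ∫ ω, (C + ∑ i ∈ s, (toMeasurable P (E i)).indicator (1 : Ω → ℝ) ω +
        ∑ j ∈ u, (toMeasurable P (F j)).indicator (1 : Ω → ℝ) ω) ∂P := by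
        refine integral_mono hf (((integrable_const C).add hE).add hF) fun ω => (h ω).trans ?_
        exact add_le_add (add_le_add le_rfl (Finset.sum_le_sum fun i _ => hle _ ω))
          (Finset.sum_le_sum fun j _ => hle _ ω)
    _ = _ := by
        have hCE : Integrable (fun ω => C + ∑ i ∈ s,
          (toMeasurable P (E i)).indicator (1 : Ω → ℝ) ω) P := (integrable_const C).add hE
        rw [integral_add hCE hF, integral_add (integrable_const C) hE,
          integral_finsetSum _ fun i _ => hint (E i), integral_finsetSum _ fun j _ => hint (F j)]
        simp only [hval, integral_const, probReal_univ, one_smul]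

theorem tendsto_log_natCast : Tendsto (fun T : ℕ => Real.log T) atTop atTop :=
  Real.tendsto_log_atTop.comp tendsto_natCast_atTop_atTop

theorem tendsto_bonus_div_log : Tendsto (fun T : ℕ => bonus T / Real.log T) atTop (𝓝 1) := by
  have h : Tendsto (fun T : ℕ => Real.log (Real.log T) / Real.log T) atTop (𝓝 0) :=
    Real.isLittleO_log_id_atTop.tendsto_div_nhds_zero.comp tendsto_log_natCast
  have h' := (h.const_mul 3).const_add 1
  simp only [mul_zero, add_zero] at h'
  refine h'.congr' ?_
  filter_upwards [eventually_ge_atTop 3] with T hT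
  have := one_lt_log hT
  unfold bonus
  field_simp

theorem sum_inv_le_log {T : ℕ} : ∑ i ∈ Finset.range T, ((i + 1 : ℕ) : ℝ)⁻¹ ≤ 1 + Real.log T := by
  have h := harmonic_le_one_add_log T
  simpa [harmonic] using h

/-- The probabilities are `o(1/t)`, so their sum is negligible against the harmonic sum, which is
`O(log T)`. -/
theorem tendsto_sum_underestimated [IsProbabilityMeasure P] {ν : Fin K → ProbabilityMeasure Θ}
    {X : Fin K → ℕ → Ω → Θ} (hX : IsRewardTable P ν X) (b : Fin K) :
    Tendsto (fun T : ℕ => (∑ t ∈ Finset.Icc 1 T,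
      P.real (underestimated X b (armMean (ν b)) t)) / Real.log T) atTop (𝓝 0) := by
  have ho : (fun i : ℕ => P.real (underestimated X b (armMean (ν b)) (i + 1))) =o[atTop]
      fun i : ℕ => ((i + 1 : ℕ) : ℝ)⁻¹ := by
    have hlim : Tendsto (fun i : ℕ => 3 * Real.exp 4 / Real.log ((i + 1 : ℕ) : ℝ)) atTop (𝓝 0) :=
      (tendsto_log_natCast.comp (tendsto_add_atTop_nat 1)).const_div_atTop _
    refine Asymptotics.isLittleO_of_tendsto' (Eventually.of_forall fun i h => ?_) ?_
    · exact absurd h (by positivity)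
    · refine squeeze_zero' (Eventually.of_forall fun i => by positivity) ?_ hlim
      filter_upwards [eventually_ge_atTop 2] with i hi
      have hl := one_lt_log (show 3 ≤ i + 1 by omega)
      have := measureReal_underestimated_le hX b (show 3 ≤ i + 1 by omega)
      rw [div_inv_eq_mul]
      have hi0 : (0 : ℝ) < ((i + 1 : ℕ) : ℝ) := by positivity
      calc _ ≤ 3 * Real.exp 4 / (((i + 1 : ℕ) : ℝ) * Real.log ((i + 1 : ℕ) : ℝ)) *
            ((i + 1 : ℕ) : ℝ) := by gcongr
        _ = _ := by field_simp
  have hdiv : Tendsto (fun n => ∑ i ∈ Finset.range n, ((i + 1 : ℕ) : ℝ)⁻¹) atTop atTop := by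
    have := Real.tendsto_sum_range_one_div_nat_succ_atTop
    simpa using this
  have hs := ho.sum_range (fun i => by positivity) hdiv
  have hO : (fun T => ∑ i ∈ Finset.range T, ((i + 1 : ℕ) : ℝ)⁻¹) =O[atTop]
      fun T : ℕ => Real.log T := by
    refine Asymptotics.IsBigO.of_bound 2 ?_
    filter_upwards [eventually_ge_atTop 3] with T hT
    have := one_lt_log hT
    have h2 := sum_inv_le_log (T := T)
    rw [Real.norm_of_nonneg (Finset.sum_nonneg fun i _ => by positivity),
      Real.norm_of_nonneg (by linarith)]
    linarith
  refine ((hs.trans_isBigO hO).tendsto_div_nhds_zero).congr fun T => ?_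
  rw [Finset.range_eq_Ico, Finset.sum_Ico_add' (fun t =>
    P.real (underestimated X b (armMean (ν b)) t)) 0 T 1]
  rfl

theorem bddAbove_sum_overestimated [IsProbabilityMeasure P] {ν : Fin K → ProbabilityMeasure Θ}
    {X : Fin K → ℕ → Ω → Θ} (hX : IsRewardTable P ν X) (a : Fin K) {p : Θ}
    (hp : armMean (ν a) < p) :
    ∃ C : ℝ, ∀ T, ∑ n ∈ Finset.range T, P.real (overestimated X a p n) ≤ C := by
  have hp' : (0 : ℝ) < (p : ℝ) - armMean (ν a) := sub_pos.2 hp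
  set r := Real.exp (-2 * ((p : ℝ) - armMean (ν a)) ^ 2) with hr
  have hr1 : r < 1 := Real.exp_lt_one_iff.2 (by nlinarith [pow_pos hp' 2])
  refine ⟨∑' n, r ^ n, fun T => ?_⟩
  exact (Finset.sum_le_sum fun n _ => measureReal_overestimated_le hX a hp n).trans
    ((summable_geometric_of_lt_one (Real.exp_pos _).le hr1).sum_le_tsum _
      fun n _ => pow_nonneg (Real.exp_pos _).le n)

theorem exists_armMean_eq_bestMean (hK : 0 < K) (ν : Fin K → ProbabilityMeasure Θ) :
    ∃ b, armMean (ν b) = bestMean ν := by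
  have : Nonempty (Fin K) := ⟨⟨0, hK⟩⟩
  obtain ⟨b, -, hb⟩ := Finset.exists_mem_eq_sup Finset.univ Finset.univ_nonempty
    fun a => armMean (ν a)
  exact ⟨b, hb.symm⟩

theorem armMean_le_bestMean (ν : Fin K → ProbabilityMeasure Θ) (a : Fin K) :
    armMean (ν a) ≤ bestMean ν :=
  Finset.le_sup (f := fun a => armMean (ν a)) (Finset.mem_univ a)

/-- Opens a gap between `p` and `p'`, needed for Hoeffding's bound, without dropping the divergence
to `c`. -/
theorem exists_lt_maxOf {D : Set (Θ → Θ → EReal)} (hcont : RightContinuousLeft (maxOf D))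
    {p q : Θ} (hpq : p < q) {c : EReal} (hc : c < maxOf D p q) :
    ∃ p', p < p' ∧ p' < q ∧ c < maxOf D p' q := by
  have : (𝓝[>] p).NeBot := nhdsGT_neBot_of_exists_gt ⟨q, hpq⟩
  have h1 := (hcont p q hpq).eventually_const_lt hc
  have h2 : ∀ᶠ p' in 𝓝[>] p, p' ∈ Set.Ioo p q := Ioo_mem_nhdsGT hpq
  obtain ⟨p', h3, h4⟩ := (h1.and h2).exists
  exact ⟨p', h4.1, h4.2, h3⟩

/-- The expected number of plays of a suboptimal arm. -/
theorem eventually_integral_pulls_le [IsProbabilityMeasure P] (hK : 0 < K) {S : Type*}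
    [MeasurableSpace S] {ν : Fin K → ProbabilityMeasure Θ} {X : Fin K → ℕ → Ω → Θ}
    (hX : IsRewardTable P ν X) {ξ : Ω → S} {A : ℕ → Ω → Fin K} (hA : IsAdmissible P X ξ A)
    {D : Set (Θ → Θ → EReal)} (hcand : ∀ d ∈ D, IsCandidateSemiDistance d)
    (hfeas : IsFeasible D) (hmax : ∀ d ∈ D, IndexExists d)
    (hcont : RightContinuousLeft (maxOf D)) (hUCB : FollowsUCBoost D 3 X A) {a : Fin K}
    (ha : armMean (ν a) < bestMean ν) {c r : ℝ} (hc0 : 0 < c)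
    (hc : (c : EReal) < maxOf D (armMean (ν a)) (bestMean ν)) (hr : 1 / c < r) :
    ∀ᶠ T : ℕ in atTop, (∫ ω, (pulls A a T ω : ℝ) ∂P) / Real.log T ≤ r := by
  obtain ⟨b, hb⟩ := exists_armMean_eq_bestMean hK ν
  obtain ⟨p, hp1, hp2, hp3⟩ := exists_lt_maxOf hcont ha hc
  obtain ⟨C, hC⟩ := bddAbove_sum_overestimated hX a hp1
  have h1 : Tendsto (fun T : ℕ => (K + 3 + C) / Real.log T + 1 / c * (bonus T / Real.log T) +
      (∑ t ∈ Finset.Icc 1 T, P.real (underestimated X b (armMean (ν b)) t)) / Real.log T)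
      atTop (𝓝 (0 + 1 / c * 1 + 0)) :=
    ((tendsto_log_natCast.const_div_atTop _).add (tendsto_bonus_div_log.const_mul _)).add
      (tendsto_sum_underestimated hX b)
  filter_upwards [h1.eventually_lt_const (show 0 + 1 / c * 1 + 0 < r by simpa using hr),
    eventually_ge_atTop 3] with T hT1 hT3
  have hl := one_lt_log hT3
  refine le_trans ?_ hT1.le
  have hint := integral_le_add_sum_measureReal (integrable_pulls hX hA a T) _ _ _ _ fun ω =>
    hUCB.pulls_le_sum hcand hfeas hmax hp2.le hp3 hc0 a b hT3 ω
  rw [hb]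
  calc _ ≤ ((K + 2 + (bonus T / c + 1)) + ∑ t ∈ Finset.Icc 1 T,
        P.real (underestimated X b (bestMean ν) t) + C) / Real.log T := by
        refine div_le_div_of_nonneg_right (hint.trans ?_) (by linarith)
        gcongr
        exact hC T
    _ = _ := by field_simp; ring

theorem exists_real_between {δ : ℝ} (hδ : 0 < δ) {M : EReal} (hM : 0 < M) {r : ℝ}
    (hr : (δ : EReal) / M < r) : ∃ c : ℝ, 0 < c ∧ (c : EReal) < M ∧ δ / c < r := by
  induction M with
  | bot => simp at hM
  | top =>
    have hr0 : 0 < r := by simpa [EReal.div_top] using hr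
    -- Any large `c` works below `⊤`; this one makes `δ / c = r / 2`.
    refine ⟨2 * δ / r, by positivity, EReal.coe_lt_top _, ?_⟩
    rw [div_div_eq_mul_div, div_lt_iff₀ (by positivity)]
    nlinarith [mul_pos hδ hr0]
  | coe m =>
    have hm : 0 < m := by exact_mod_cast hM
    rw [← EReal.coe_div, EReal.coe_lt_coe_iff] at hr
    have hr0 : 0 < r := (div_pos hδ hm).trans hr
    have h : δ / r < m := by rwa [div_lt_comm₀ hr0 hm]
    obtain ⟨c, hc1, hc2⟩ := exists_between h
    have hc0 : 0 < c := (div_pos hδ hr0).trans hc1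
    exact ⟨c, hc0, by exact_mod_cast hc2, by rwa [div_lt_comm₀ hc0 hr0]⟩

theorem exists_div_eq_coe (δ : ℝ) {M : EReal} (hM : 0 < M) : ∃ ρ : ℝ, (δ : EReal) / M = ρ := by
  induction M with
  | bot => simp at hM
  | top => exact ⟨0, by simp [EReal.div_top]⟩
  | coe m => exact ⟨δ / m, (EReal.coe_div δ m).symm⟩

theorem coe_finsetSum {ι : Type*} (s : Finset ι) (f : ι → ℝ) :
    ((∑ i ∈ s, f i : ℝ) : EReal) = ∑ i ∈ s, (f i : EReal) := by
  classical
  induction s using Finset.induction_on with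
  | empty => simp
  | insert a s ha ih => rw [Finset.sum_insert ha, Finset.sum_insert ha, EReal.coe_add, ih]

end Regret

end UCBoost

theorem theorem2 {K : ℕ} (hK : 0 < K)
    {Ω S : Type*} [MeasurableSpace Ω] [MeasurableSpace S]
    (P : MeasureTheory.Measure Ω) [MeasureTheory.IsProbabilityMeasure P]
    (ν : Fin K → MeasureTheory.ProbabilityMeasure UCBoost.Θ)
    (X : Fin K → ℕ → Ω → UCBoost.Θ) (hX : UCBoost.IsRewardTable P ν X)
    (ξ : Ω → S) (A : ℕ → Ω → Fin K) (hA : UCBoost.IsAdmissible P X ξ A)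
    (D : Set (UCBoost.Θ → UCBoost.Θ → EReal))
    (hcand : ∀ d ∈ D, UCBoost.IsCandidateSemiDistance d)
    (hfeas : UCBoost.IsFeasible D)
    (hmax : ∀ d ∈ D, UCBoost.IndexExists d)
    (hcont : UCBoost.RightContinuousLeft (UCBoost.maxOf D))
    (hUCB : UCBoost.FollowsUCBoost D 3 X A) :
    Filter.limsup
        (fun T : ℕ => ((UCBoost.regret P ν X A T / Real.log T : ℝ) : EReal)) Filter.atTop ≤
      ∑ a : Fin K with UCBoost.armMean (ν a) < UCBoost.bestMean ν,
        (((UCBoost.bestMean ν : ℝ) - (UCBoost.armMean (ν a) : ℝ) : ℝ) : EReal) /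
          UCBoost.maxOf D (UCBoost.armMean (ν a)) (UCBoost.bestMean ν) := by
  open UCBoost in
  set Δ : Fin K → ℝ := fun a => (bestMean ν : ℝ) - (armMean (ν a) : ℝ) with hΔ
  set M : Fin K → EReal := fun a => maxOf D (armMean (ν a)) (bestMean ν) with hMdef
  set s : Finset (Fin K) := Finset.univ.filter fun a => armMean (ν a) < bestMean ν with hs
  have hΔpos : ∀ a ∈ s, 0 < Δ a := fun a ha => sub_pos.2 (Finset.mem_filter.1 ha).2
  have hM : ∀ a ∈ s, 0 < M a := fun a ha =>
    (hfeas.strong.nonneg _ _).lt_of_ne' fun h =>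
      (Finset.mem_filter.1 ha).2.ne ((hfeas.strong.eq_zero_iff _ _).1 h)
  -- Positive denominators make every term finite, so the rest is real arithmetic.
  have hreal : ∀ a ∈ s, ∃ ρ : ℝ, (Δ a : EReal) / M a = ρ := fun a ha =>
    exists_div_eq_coe (Δ a) (hM a ha)
  choose! ρ hρ using hreal
  have hsum : ∑ a ∈ s, (Δ a : EReal) / M a = ((∑ a ∈ s, ρ a : ℝ) : EReal) := by
    rw [Finset.sum_congr rfl hρ, coe_finsetSum]
  show _ ≤ ∑ a ∈ s, (Δ a : EReal) / M a
  rw [hsum]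
  refine EReal.le_of_forall_lt_iff_le.1 fun z hz => ?_
  rw [EReal.coe_lt_coe_iff] at hz
  have harm : ∀ ε : ℝ, 0 < ε → ∀ a ∈ s, ∀ᶠ T : ℕ in Filter.atTop,
      Δ a * (∫ ω, (pulls A a T ω : ℝ) ∂P) / Real.log T ≤ ρ a + ε := by
    intro ε hε a ha
    obtain ⟨c, hc0, hcM, hc⟩ := exists_real_between (hΔpos a ha) (hM a ha) (r := ρ a + ε)
      (by rw [hρ a ha]; exact_mod_cast lt_add_of_pos_right (ρ a) hε)
    have h1 : 1 / c < (ρ a + ε) / Δ a := by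
      rw [lt_div_iff₀ (hΔpos a ha)]
      calc 1 / c * Δ a = Δ a / c := by ring
        _ < _ := hc
    filter_upwards [eventually_integral_pulls_le hK hX hA hcand hfeas hmax hcont hUCB
      (Finset.mem_filter.1 ha).2 hc0 hcM h1] with T hT
    rw [le_div_iff₀' (hΔpos a ha)] at hT
    rwa [mul_div_assoc]
  -- The slack below `z` is shared equally among at most `K` suboptimal arms.
  set ε : ℝ := (z - ∑ a ∈ s, ρ a) / K with hε
  have hK' : (0 : ℝ) < K := by exact_mod_cast hK
  have hε0 : 0 < ε := div_pos (sub_pos.2 hz) hK'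
  refine Filter.limsup_le_of_le (by isBoundedDefault) ?_
  filter_upwards [(Filter.eventually_all_finset s).2 (harm ε hε0)] with T hT
  rw [EReal.coe_le_coe_iff, regret_eq_sum hX hA, Finset.sum_div]
  calc ∑ a, Δ a * (∫ ω, (pulls A a T ω : ℝ) ∂P) / Real.log T
      = ∑ a ∈ s, Δ a * (∫ ω, (pulls A a T ω : ℝ) ∂P) / Real.log T := by
        refine (Finset.sum_subset (Finset.subset_univ s) fun a _ ha => ?_).symm
        have : armMean (ν a) = bestMean ν := by
          by_contra h
          exact ha (Finset.mem_filter.2 ⟨Finset.mem_univ a, lt_of_le_of_ne (armMean_le_bestMean ν a) h⟩)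
        simp [hΔ, this]
    _ ≤ ∑ a ∈ s, (ρ a + ε) := Finset.sum_le_sum hT
    _ = ∑ a ∈ s, ρ a + s.card * ε := by simp [Finset.sum_add_distrib]
    _ ≤ ∑ a ∈ s, ρ a + K * ε := by
        gcongr
        simpa using Finset.card_le_univ s
    _ = z := by rw [hε]; field_simp; ring
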